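/- Let $H$ be a finite simple graph and $M$ a matching in $H$ (in particular, $H$ may be the contracted graph whose augmenting paths correspond to the shortest augmenting paths of an input graph $G$). A vertex is free if it is not incident to an edge of $M$; the mate of a matched vertex is the other endpoint of its matching edge. An augmenting path is a simple path joining two distinct free vertices whose edges are alternately outside and inside $M$. The procedure $\mathrm{find\_ap\_set}$ maintains a search forest $S$ (with parent pointers), a partition of its vertices into blossoms (the blossom containing $v$ has a base $b(v)$; initially all blossoms are singletons, so $b(v)=v$), a set of even vertices (the other vertices of $S$ are odd), a canonical path $P(v)$ for every even vertex $v$, and a set $CP$ of paths. Descendants, parents and tree paths in $S$ refer to the forest in which every blossom is contracted to its base. Initially $S$ and $CP$ are empty. For each free vertex $f$, in arbitrary order: if $f$ does not lie on a path of $CP$, then $f$ is added to $S$ as the root of a new tree, as an even vertex with $P(f)=f$, and $\mathrm{find\_ap}(f)$ is called. The call $\mathrm{find\_ap}(x)$ scans the non-matching edges $xy$ incident to $x$ in arbitrary order; when $xy$ is scanned: 1. If $y\notin V(S)$ and $y$ is free, then $xy$ is added to $S$, the path $P(x)\,y$ is added to $CP$, and all currently executing calls of $\mathrm{find\_ap}$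 are terminated. 2. If $y\notin V(S)$ and $y$ has a mate $y'$, then $y$ is added to $S$ as an odd child of $x$ and $y'$ as an even child of $y$, with $P(y')=P(x)\,y\,y'$, and $\mathrm{find\_ap}(y')$ is called. 3. If $y\in V(S)$ and $b(y)$ is an even proper descendant of $b(x)$ (blossom step), let $u_1,\dots,u_k$ be the odd vertices on the tree path from $b(x)$ to $b(y)$, with $u_1$ closest to $b(x)$. All blossoms on this path are combined into one blossom with base $b(x)$; the $u_i$ become even, $P(u_i)$ being $P(x)$ followed by the edge $xy$ and by the reversal of the part of $P(y)$ from $u_i$ to $y$. Then $\mathrm{find\_ap}(u_1),\dots,\mathrm{find\_ap}(u_k)$ are called in this order. 4. Otherwise nothing is done. Then, whatever orders are chosen for the free vertices and for the scanned edges, $\mathrm{find\_ap\_set}$ terminates, and at termination $CP$ is a maximal set of vertex-disjoint augmenting paths in $H$ with respect to $M$: every member of $CP$ is an augmenting path, no two members share a vertex, and there is no augmenting path in $H$ that is vertex-disjoint from all paths in $CP$. -/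

import Mathlib

namespace MaxAugPaths

variable {V : Type*}

section AugmentingPaths

variable {H : SimpleGraph V}

/-- A vertex is free if no edge of the matching `M` is incident to it
(for `M.IsMatching`, the vertices of `M` are exactly the matched ones). -/
def IsFree (M : H.Subgraph) (v : V) : Prop := v ∉ M.verts

/-- A simple path of `H`, given as the list of its vertices, that joins two distinct free vertices
and whose edges are alternately non-matching and matching. -/
structure IsAugmentingPath (M : H.Subgraph) (p : List V) : Prop where
  two_le : 2 ≤ p.length
  nodup : p.Nodup
  isChain : p.IsChain H.Adj
  alternating : ∀ (i : ℕ) (hi : i + 1 < p.length), M.Adj p[i] p[i + 1] ↔ Odd i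
  head_free : ∀ v, p.head? = some v → IsFree M v
  last_free : ∀ v, p.getLast? = some v → IsFree M v

/-- `C` is a maximal set of vertex-disjoint augmenting paths: its members are augmenting paths,
no two of them share a vertex, and no augmenting path is disjoint from all of them. -/
structure IsMaximalAugmentingSet (M : H.Subgraph) (C : Set (List V)) : Prop where
  augmenting : ∀ p ∈ C, IsAugmentingPath M p
  disjoint : ∀ p ∈ C, ∀ q ∈ C, p ≠ q → List.Disjoint p q
  maximal : ¬ ∃ p, IsAugmentingPath M p ∧ ∀ q ∈ C, List.Disjoint p q

end AugmentingPaths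

/-- The entries of the recursion stack. -/
inductive Frame (V : Type*) where
  /-- A call `find_ap x`; `E` is the set of those `y` for which the non-matching edge `xy` has
  not been scanned yet by this call. -/
  | scan (x : V) (E : Set V)
  /-- The loop at the end of a blossom step: `find_ap` still has to be called for the vertices of
  the list `us`, in this order. -/
  | calls (us : List V)

/-- A state of the execution of `find_ap_set`. -/
structure State (V : Type*) where
  /-- the vertex set of the search structure `S` -/
  verts : Set V
  /-- the edges of the trees of `S`: `parent v` is the vertex from which `v` was added to `S`
  (`none` for the roots) -/
  parent : V → Option V
  /-- `base v` is the base of the blossom containing `v`; it represents the blossom, that is, the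
  node of the contracted search structure that contains `v` -/
  base : V → V
  /-- the even vertices -/
  even : Set V
  /-- the canonical path `P(v)` from a root to the even vertex `v` -/
  path : V → List V
  /-- the set `CP` of collected augmenting paths -/
  paths : Set (List V)
  /-- the free vertices not yet considered by the main loop -/
  todo : Set V
  /-- the recursion stack, with the innermost call first -/
  stack : List (Frame V)

namespace State

/-- The vertices that lie on a collected path. -/
def pathVerts (σ : State V) : Set V := {v | ∃ p ∈ σ.paths, v ∈ p}

/-- In the search structure with all blossoms contracted to their bases, `a` is the parent
of `b`. -/
def NodeParent (σ : State V) (a b : V) : Prop := ∃ w, σ.parent b = some w ∧ σ.base w = a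

/-- `b` is a proper descendant of `a` in the contracted search structure. -/
def IsProperDescendant (σ : State V) (b a : V) : Prop := Relation.TransGen σ.NodeParent a b

/-- `p` is the tree path from `a` down to `b` in the contracted search structure. -/
def IsTreePath (σ : State V) (p : List V) (a b : V) : Prop :=
  p.head? = some a ∧ p.getLast? = some b ∧ p.IsChain σ.NodeParent

open Classical in
/-- Add the free vertex `f` to `S` as the root of a new search tree. -/
noncomputable def addRoot (σ : State V) (f : V) : State V :=
  { σ with
    verts := insert f σ.verts
    even := insert f σ.even
    path := Function.update σ.path f [f] }

open Classical in
/-- The free vertex `y` completes an augmenting path: `xy` is added to `S`, the path `P(x) y` is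
added to `CP`, and all currently executing calls of `find_ap` are terminated. -/
noncomputable def augment (σ : State V) (x y : V) : State V :=
  { σ with
    verts := insert y σ.verts
    parent := Function.update σ.parent y (some x)
    paths := insert (σ.path x ++ [y]) σ.paths
    stack := [] }

open Classical in
/-- Grow step: add `xy` and the matching edge `yy'` to `S`, with `P(y') = P(x) y y'`. -/
noncomputable def grow (σ : State V) (x y y' : V) : State V :=
  { σ with
    verts := insert y (insert y' σ.verts)
    parent := Function.update (Function.update σ.parent y (some x)) y' (some y)
    even := insert y' σ.even
    path := Function.update σ.path y' (σ.path x ++ [y, y']) }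

open Classical in
/-- The odd vertices on the tree path `p`, in the order of `p`. -/
noncomputable def oddVerts (σ : State V) (p : List V) : List V := p.filter (· ∉ σ.even)

open Classical in
/-- The suffix of the path `l` that starts in its vertex `u`. -/
noncomputable def suffixFrom (l : List V) (u : V) : List V := l.dropWhile (· ≠ u)

open Classical in
/-- Blossom step for the edge `xy`, where `p` is the tree path from `b(x)` to `b(y)`: all blossoms
on `p` are combined into one with base `b(x)`, and the odd vertices `u` on `p` become even. The
canonical path of such a `u` is `P(x)` followed by the edge `xy` and by the reversal of the suffix
of `P(y)` that starts in `u`. -/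
noncomputable def shrink (σ : State V) (x y : V) (p : List V) : State V :=
  { σ with
    base := fun z => if σ.base z ∈ p then σ.base x else σ.base z
    even := σ.even ∪ {u | u ∈ σ.oddVerts p}
    path := fun z => if z ∈ σ.oddVerts p then σ.path x ++ (suffixFrom (σ.path y) z).reverse
      else σ.path z }

end State

variable {H : SimpleGraph V}

/-- The recursion-stack entry of a fresh call `find_ap x`: all non-matching edges `xy` have to be
scanned. -/
def call (M : H.Subgraph) (x : V) : Frame V := .scan x {y | H.Adj x y ∧ ¬ M.Adj x y}

/-- The initial state of `find_ap_set`: `S` and `CP` are empty. -/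
def init (M : H.Subgraph) : State V where
  verts := ∅
  parent := fun _ => none
  base := id
  even := ∅
  path := fun _ => []
  paths := ∅
  todo := {f | IsFree M f}
  stack := []

/-- One step of `find_ap_set`. The main loop takes the free vertices, and each call `find_ap x`
takes the non-matching edges incident to `x`, in an arbitrary order. -/
inductive Step (M : H.Subgraph) : State V → State V → Prop
  /-- Main loop, `f ∈ V(CP)`: nothing is done. -/
  | skipRoot (σ : State V) (f : V) :
      σ.stack = [] → f ∈ σ.todo → f ∈ σ.pathVerts →
      Step M σ { σ with todo := σ.todo \ {f} }
  /-- Main loop, `f ∉ V(CP)`: `f` becomes a root and `find_ap f` is called. -/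
  | newRoot (σ : State V) (f : V) :
      σ.stack = [] → f ∈ σ.todo → f ∉ σ.pathVerts →
      Step M σ { σ.addRoot f with todo := σ.todo \ {f}, stack := [call M f] }
  /-- Scan `xy` from `x`, where `y` is not in `S` and is free. -/
  | augment (σ : State V) (x y : V) (E : Set V) (K : List (Frame V)) :
      σ.stack = .scan x E :: K → y ∈ E → y ∉ σ.verts → IsFree M y →
      Step M σ (σ.augment x y)
  /-- Scan `xy` from `x`, where `y` is not in `S` and is matched to `y'`. -/
  | grow (σ : State V) (x y y' : V) (E : Set V) (K : List (Frame V)) :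
      σ.stack = .scan x E :: K → y ∈ E → y ∉ σ.verts → M.Adj y y' →
      Step M σ { σ.grow x y y' with stack := call M y' :: .scan x (E \ {y}) :: K }
  /-- Scan `xy` from `x`, where `y` is in `S` and `b(y)` is an even proper descendant of `b(x)`. -/
  | blossom (σ : State V) (x y : V) (p : List V) (E : Set V) (K : List (Frame V)) :
      σ.stack = .scan x E :: K → y ∈ E → y ∈ σ.verts →
      σ.base y ∈ σ.even → σ.IsProperDescendant (σ.base y) (σ.base x) →
      σ.IsTreePath p (σ.base x) (σ.base y) →
      Step M σ { σ.shrink x y p with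
        stack := .calls (σ.oddVerts p) :: .scan x (E \ {y}) :: K }
  /-- Scan `xy` from `x`, where `y` is in `S` and `b(y)` is not an even proper descendant of
  `b(x)`: nothing is done. -/
  | skipEdge (σ : State V) (x y : V) (E : Set V) (K : List (Frame V)) :
      σ.stack = .scan x E :: K → y ∈ E → y ∈ σ.verts →
      ¬ (σ.base y ∈ σ.even ∧ σ.IsProperDescendant (σ.base y) (σ.base x)) →
      Step M σ { σ with stack := .scan x (E \ {y}) :: K }
  /-- The call `find_ap x` has scanned all its edges and returns. -/
  | scanDone (σ : State V) (x : V) (K : List (Frame V)) :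
      σ.stack = .scan x ∅ :: K → Step M σ { σ with stack := K }
  /-- The loop of a blossom step calls `find_ap` for the next vertex `u`. -/
  | callNext (σ : State V) (u : V) (us : List V) (K : List (Frame V)) :
      σ.stack = .calls (u :: us) :: K →
      Step M σ { σ with stack := call M u :: .calls us :: K }
  /-- The loop of a blossom step ends. -/
  | callsDone (σ : State V) (K : List (Frame V)) :
      σ.stack = .calls [] :: K → Step M σ { σ with stack := K }

/-- `find_ap_set` has ended: no call is executing and every free vertex has been considered. -/
def Finished (σ : State V) : Prop := σ.stack = [] ∧ σ.todo = ∅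

end MaxAugPaths

/-!
The proof follows the search with three invariants.

`SearchInv` describes the search structure by local facts: the parent of a matched base is its odd
mate, whose parent is even; a matched vertex that is not the base of its blossom has its mate in
the same blossom; the canonical path of an even vertex extends the one of its base inside the
blossom, and the canonical path of a matched base extends the one of its grandparent. By induction
on the length of the paths, a canonical path runs down the tree path to its blossom, and from each
node on that tree path it stays below that node (`SearchInv.anc_of_mem_path`,
`SearchInv.path_eq_of_anc`, `SearchInv.path_eq_of_odd_anc`). This makes the paths that a blossom
step creates simple and alternating (`SearchInv.shrink`).

`StackInv` contains the depth-first properties. The vertices with an executing or pending call all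
lie on the canonical path of the innermost one; when an augmenting path is collected, it therefore
takes away all vertices that have not been scanned completely. The key property is `scanned_anc`:
if `xy` has been scanned from `x`, then every active node above `y` is above `x`. It holds trivially
when `xy` is scanned, since `x` is then the innermost call, and it is preserved because inactive
nodes never become active again. When `yx` is scanned from the other end, it says that `b(x)` is
equal to `b(y)` or a proper descendant of it, and in the second case a blossom step is made. So
every edge that has been scanned from both ends joins two vertices of one blossom (`scanned_base`).

`PathsInv` says that the collected paths are disjoint augmenting paths and that each free vertex
outside them becomes the root of a tree.

At the end every even vertex outside the collected paths has been scanned. Consider an augmenting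
path outside the collected paths. After each matching edge it is at an even vertex, in a blossom
whose base it has already visited (`Inv.even_of_isAugmentingPath`): a non-matching edge leads to an
odd vertex, whose mate is a base, or stays in the blossom and does not end in the base, so that the
mate lies in the blossom as well. But the free end of the path is the base of its blossom, and it
is not visited before the end: a contradiction.

For termination, each step decreases lexicographically the numbers of unconsidered free vertices,
of vertices outside the search structure and of vertices that are not even, and a weight of the
stack.
-/

namespace MaxAugPaths

variable {V : Type*} {H : SimpleGraph V}

/-! ### Alternating lists -/

/-- `l` is the vertex list of a walk of `H` whose edges alternate with respect to `M`; the edges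
are numbered from `n` on, and the matching edges are those with an odd number. -/
def AltFrom (M : H.Subgraph) : ℕ → List V → Prop
  | n, a :: b :: l => H.Adj a b ∧ (M.Adj a b ↔ Odd n) ∧ AltFrom M (n + 1) (b :: l)
  | _, _ => True

theorem altFrom_add_even (M : H.Subgraph) {k : ℕ} (hk : Even k) (n : ℕ) (l : List V) :
    AltFrom M (n + k) l ↔ AltFrom M n l := by
  induction l generalizing n with
  | nil => simp [AltFrom]
  | cons a l ih =>
    cases l with
    | nil => simp [AltFrom]
    | cons b l =>
      have h : Odd (n + k) ↔ Odd n := by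
        rw [Nat.odd_add]; exact iff_true_right hk
      have := ih (n + 1)
      rw [show n + 1 + k = n + k + 1 by ring] at this
      simp only [AltFrom, this, h]

theorem altFrom_append (M : H.Subgraph) (n : ℕ) (l₁ l₂ : List V) :
    AltFrom M n (l₁ ++ l₂) ↔ AltFrom M n l₁ ∧ AltFrom M (n + l₁.length) l₂ ∧
      ∀ a ∈ l₁.getLast?, ∀ b ∈ l₂.head?, H.Adj a b ∧ (M.Adj a b ↔ Even (n + l₁.length)) := by
  induction l₁ generalizing n with
  | nil => simp [AltFrom]
  | cons a l₁ ih =>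
    cases l₁ with
    | nil =>
      cases l₂ with
      | nil => simp [AltFrom]
      | cons b l₂ =>
        simp only [AltFrom, List.cons_append, List.nil_append, List.length_singleton,
          List.getLast?_singleton, Option.mem_def, Option.some.injEq, forall_eq', List.head?_cons,
          true_and, Nat.even_add_one, Nat.not_even_iff_odd]
        tauto
    | cons b l₁ =>
      have := ih (n + 1)
      rw [List.cons_append] at this
      simp only [List.cons_append, AltFrom, this, List.getLast?_cons_cons, List.length_cons]
      rw [show n + 1 + (l₁.length + 1) = n + (l₁.length + 1 + 1) by ring]
      tauto

theorem AltFrom.reverse {M : H.Subgraph} {n : ℕ} {l : List V} (h : AltFrom M n l) :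
    AltFrom M (n + l.length) l.reverse := by
  induction l generalizing n with
  | nil => simp [AltFrom]
  | cons a l ih =>
    cases l with
    | nil => simp [AltFrom]
    | cons b l =>
      obtain ⟨h1, h2, h3⟩ := h
      have h4 := ih h3
      rw [List.reverse_cons, altFrom_append]
      refine ⟨?_, trivial, ?_⟩
      · rwa [show n + (a :: b :: l).length = n + 1 + (b :: l).length by simp; ring]
      · simp only [List.getLast?_reverse, List.head?_cons, Option.mem_def, Option.some.injEq,
          forall_eq', List.length_reverse]
        refine ⟨h1.symm, ?_⟩
        rw [M.adj_comm, h2, show n + (a :: b :: l).length + (b :: l).length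
          = n + 1 + ((b :: l).length + (b :: l).length) by simp; ring, Nat.even_add,
          Nat.even_add_one, Nat.not_even_iff_odd]
        exact (iff_true_right ⟨_, rfl⟩).symm

theorem AltFrom.isChain {M : H.Subgraph} {n : ℕ} {l : List V} (h : AltFrom M n l) :
    l.IsChain H.Adj := by
  induction l generalizing n with
  | nil => simp
  | cons a l ih =>
    cases l with
    | nil => simp
    | cons b l => exact List.isChain_cons_cons.2 ⟨h.1, ih h.2.2⟩

theorem AltFrom.adj_iff {M : H.Subgraph} {n : ℕ} {l : List V} (h : AltFrom M n l)
    (i : ℕ) (hi : i + 1 < l.length) : M.Adj l[i] l[i + 1] ↔ Odd (n + i) := by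
  induction l generalizing n i with
  | nil => simp at hi
  | cons a l ih =>
    cases l with
    | nil => simp at hi
    | cons b l =>
      cases i with
      | zero => exact h.2.1
      | succ i =>
        have := ih h.2.2 i (by simpa using hi)
        rw [show n + (i + 1) = n + 1 + i by ring]
        simpa using this

/-- `l` is a simple alternating path that starts in a free vertex with a non-matching edge and ends
in `v` with a matching edge (or `v` is free and `l = [v]`). -/
structure IsEvenPath (M : H.Subgraph) (l : List V) (v : V) : Prop where
  head_free : ∀ f, l.head? = some f → IsFree M f
  getLast : l.getLast? = some v
  nodup : l.Nodup
  odd_length : Odd l.length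
  alt : AltFrom M 0 l

theorem IsEvenPath.mem {M : H.Subgraph} {l : List V} {v : V} (h : IsEvenPath M l v) : v ∈ l :=
  List.mem_of_getLast? h.getLast

theorem IsEvenPath.ne_nil {M : H.Subgraph} {l : List V} {v : V} (h : IsEvenPath M l v) :
    l ≠ [] := List.ne_nil_of_mem h.mem

theorem IsEvenPath.singleton {M : H.Subgraph} {f : V} (hf : IsFree M f) : IsEvenPath M [f] f where
  head_free := by simpa using hf
  getLast := rfl
  nodup := List.nodup_singleton f
  odd_length := odd_one
  alt := trivial

theorem IsEvenPath.head?_append {M : H.Subgraph} {l : List V} {v : V} (h : IsEvenPath M l v)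
    (l' : List V) : (l ++ l').head? = l.head? := by
  rw [List.head?_append_of_ne_nil _ h.ne_nil]

/-- Extension of an even path by a non-matching and a matching edge. -/
theorem IsEvenPath.grow {M : H.Subgraph} {l : List V} {x y y' : V} (h : IsEvenPath M l x)
    (hxy : H.Adj x y) (hxy' : ¬ M.Adj x y) (hyy' : M.Adj y y') (hy : y ∉ l) (hy' : y' ∉ l) :
    IsEvenPath M (l ++ [y, y']) y' where
  head_free f hf := h.head_free f (by rwa [h.head?_append] at hf)
  getLast := by simp
  nodup := by
    rw [List.nodup_append']
    refine ⟨h.nodup, by simpa using hyy'.ne, ?_⟩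
    intro z hz hz'
    simp only [List.mem_cons, List.not_mem_nil, or_false] at hz'
    rcases hz' with rfl | rfl <;> contradiction
  odd_length := by
    simpa [Nat.odd_add] using h.odd_length
  alt := by
    have ho := h.odd_length
    rw [altFrom_append]
    refine ⟨h.alt, ⟨hyy'.adj_sub, ?_, trivial⟩, ?_⟩
    · simpa [hyy'] using ho
    · simp only [h.getLast, Option.mem_def, Option.some.injEq, List.head?_cons, forall_eq']
      refine ⟨hxy, iff_of_false hxy' ?_⟩
      simpa using ho

/-- Extension of an even path to a free vertex outside it. -/
theorem IsEvenPath.isAugmentingPath {M : H.Subgraph} {l : List V} {x y : V} (h : IsEvenPath M l x)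
    (hxy : H.Adj x y) (hfree : IsFree M y) (hy : y ∉ l) : IsAugmentingPath M (l ++ [y]) := by
  have hxy' : ¬ M.Adj x y := fun h' => hfree h'.snd_mem
  have halt : AltFrom M 0 (l ++ [y]) := by
    have ho := h.odd_length
    rw [altFrom_append]
    refine ⟨h.alt, trivial, ?_⟩
    simp only [h.getLast, Option.mem_def, Option.some.injEq, List.head?_cons, forall_eq']
    refine ⟨hxy, iff_of_false hxy' ?_⟩
    simpa using ho
  refine ⟨?_, ?_, halt.isChain, ?_, ?_, ?_⟩
  · have := List.length_pos_of_mem h.mem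
    simp only [List.length_append, List.length_singleton]
    omega
  · rw [List.nodup_append']
    exact ⟨h.nodup, List.nodup_singleton y, by simpa using hy⟩
  · intro i hi
    simpa using halt.adj_iff i hi
  · intro f hf
    exact h.head_free f (by rwa [h.head?_append] at hf)
  · simpa using hfree

/-- The canonical path of a vertex that becomes even in a blossom step: an even path to `x`, then
the non-matching edge `xy`, then an even path to `y` backwards until its odd vertex `u`. -/
theorem IsEvenPath.blossom {M : H.Subgraph} {l l₁ s : List V} {x y w u : V}
    (hx : IsEvenPath M l x) (hy : IsEvenPath M (l₁ ++ u :: s) y) (hw : IsEvenPath M l₁ w)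
    (hxy : H.Adj x y) (hxy' : ¬ M.Adj x y) (hdisj : ∀ z ∈ u :: s, z ∉ l) :
    IsEvenPath M (l ++ (u :: s).reverse) u where
  head_free f hf := hx.head_free f (by rwa [hx.head?_append] at hf)
  getLast := by simp
  nodup := by
    rw [List.nodup_append']
    refine ⟨hx.nodup, List.nodup_reverse.2 (List.nodup_append'.1 hy.nodup).2.1, ?_⟩
    intro z hz hz'
    exact hdisj z (List.mem_reverse.1 hz') hz
  odd_length := by
    have h1 := hx.odd_length
    have h2 := hy.odd_length
    have h3 := hw.odd_length
    rw [List.length_append] at h2 ⊢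
    rw [List.length_reverse]
    grind
  alt := by
    have h1 := hx.odd_length
    have h2 := hy.odd_length
    have h3 := hw.odd_length
    have h4 := ((altFrom_append M _ _ _).1 hy.alt).2.1.reverse
    rw [List.length_append] at h2
    rw [altFrom_append]
    refine ⟨hx.alt, ?_, ?_⟩
    · have e1 : Even (l₁.length + (u :: s).length + l.length) := by grind
      rw [← altFrom_add_even M e1] at h4
      have e2 : Even (l₁.length + (u :: s).length + (l₁.length + (u :: s).length)) :=
        ⟨_, rfl⟩
      rw [← altFrom_add_even M e2]
      convert h4 using 1
      ring
    · have h5 := hy.getLast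
      rw [List.getLast?_append_of_ne_nil _ (List.cons_ne_nil u s)] at h5
      simp only [hx.getLast, Option.mem_def, Option.some.injEq, List.head?_reverse, h5, forall_eq']
      refine ⟨hxy, iff_of_false hxy' ?_⟩
      simpa using h1

/-! ### The search structure -/

/-- `a` is an ancestor of `b`, or `b` itself, in the contracted search structure. -/
def State.Anc (σ : State V) (a b : V) : Prop := Relation.ReflTransGen σ.NodeParent a b

/-- The properties of the search structure, its blossoms and its canonical paths that every step
preserves. All of them are local: they relate a vertex to its parent, its mate and its base. -/
structure SearchInv (M : H.Subgraph) (σ : State V) : Prop where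
  even_subset : σ.even ⊆ σ.verts
  mem_of_parent : ∀ {v w}, σ.parent v = some w → v ∈ σ.verts ∧ w ∈ σ.verts
  base_of_not_even : ∀ {v}, v ∉ σ.even → σ.base v = v
  base_mem_even : ∀ {v}, v ∈ σ.even → σ.base v ∈ σ.even
  base_base : ∀ v, σ.base (σ.base v) = σ.base v
  /-- The contracted search structure is acyclic. -/
  rank : ∃ r : V → ℕ, (∀ v w, σ.parent v = some w → r w < r v) ∧ ∀ v, r (σ.base v) ≤ r v
  /-- The only child of an odd vertex is its mate, which is the base of its blossom. -/
  child_of_odd : ∀ {v w}, σ.parent v = some w → w ∉ σ.even →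
    M.Adj w v ∧ v ∈ σ.even ∧ σ.base v = v
  /-- The parent of a matched base is its mate, an odd vertex, whose parent is even. -/
  parent_of_base : ∀ {v}, v ∈ σ.even → v ∈ M.verts → σ.base v = v →
    ∃ u w, σ.parent v = some u ∧ M.Adj u v ∧ u ∉ σ.even ∧ σ.parent u = some w ∧ w ∈ σ.even ∧
      σ.path v = σ.path w ++ [u, v]
  base_mate : ∀ {v v'}, v ∈ σ.even → σ.base v ≠ v → M.Adj v v' → σ.base v' = σ.base v
  mate_of_odd : ∀ {u v}, u ∈ σ.verts → u ∉ σ.even → M.Adj u v →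
    v ∈ σ.even ∧ σ.base v = v ∧ σ.parent v = some u
  free_even : ∀ {v}, v ∈ σ.even → IsFree M v →
    σ.base v = v ∧ σ.parent v = none ∧ σ.path v = [v]
  mate_mem : ∀ {v v'}, M.Adj v v' → v ∈ σ.verts → v' ∈ σ.verts
  path_eq : ∀ {v}, v ∈ σ.even →
    ∃ R, σ.path v = σ.path (σ.base v) ++ R ∧ ∀ z ∈ R, σ.base z = σ.base v
  isEvenPath : ∀ {v}, v ∈ σ.even → IsEvenPath M (σ.path v) v
  path_subset : ∀ {v}, v ∈ σ.even → ∀ z ∈ σ.path v, z ∈ σ.verts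

theorem SearchInv.init (M : H.Subgraph) : SearchInv M (init M) where
  even_subset := fun _ h => h
  mem_of_parent := by simp [MaxAugPaths.init]
  base_of_not_even := by simp [MaxAugPaths.init]
  base_mem_even := by simp [MaxAugPaths.init]
  base_base := by simp [MaxAugPaths.init]
  rank := ⟨fun _ => 0, by simp [MaxAugPaths.init]⟩
  child_of_odd := by simp [MaxAugPaths.init]
  parent_of_base := by simp [MaxAugPaths.init]
  base_mate := by simp [MaxAugPaths.init]
  mate_of_odd := by simp [MaxAugPaths.init]
  free_even := by simp [MaxAugPaths.init]
  mate_mem := by simp [MaxAugPaths.init]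
  path_eq := by simp [MaxAugPaths.init]
  isEvenPath := by simp [MaxAugPaths.init]
  path_subset := by simp [MaxAugPaths.init]

namespace SearchInv

variable {M : H.Subgraph} {σ : State V}

/-- The search structure does not depend on the recursion stack and the main loop. -/
theorem withStack (h : SearchInv M σ) (T : Set V) (K : List (Frame V)) :
    SearchInv M { σ with todo := T, stack := K } :=
  ⟨h.1, h.2, h.3, h.4, h.5, h.6, h.7, h.8, h.9, h.10, h.11, h.12, h.13, h.14, h.15⟩

theorem base_mem_even_iff (h : SearchInv M σ) {v : V} : σ.base v ∈ σ.even ↔ v ∈ σ.even := by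
  refine ⟨fun hv => ?_, h.base_mem_even⟩
  by_contra hv'
  rw [h.base_of_not_even hv'] at hv
  exact hv' hv

theorem base_eq_of_not_even (h : SearchInv M σ) {v u : V} (hu : u ∉ σ.even) (hv : σ.base v = u) :
    v = u := by
  have : v ∉ σ.even := fun h' => hu (hv ▸ h.base_mem_even h')
  rwa [h.base_of_not_even this] at hv

theorem base_of_not_mem (h : SearchInv M σ) {v : V} (hv : v ∉ σ.verts) : σ.base v = v :=
  h.base_of_not_even fun h' => hv (h.even_subset h')

theorem base_mem_verts (h : SearchInv M σ) {v : V} (hv : v ∈ σ.verts) : σ.base v ∈ σ.verts := by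
  by_cases he : v ∈ σ.even
  · exact h.even_subset (h.base_mem_even he)
  · rwa [h.base_of_not_even he]

theorem parent_of_not_mem (h : SearchInv M σ) {v : V} (hv : v ∉ σ.verts) : σ.parent v = none :=
  Option.eq_none_iff_forall_ne_some.2 fun _ hw => hv (h.mem_of_parent hw).1

theorem nodeParent_mem (h : SearchInv M σ) {a b : V} (hab : σ.NodeParent a b) :
    a ∈ σ.verts ∧ b ∈ σ.verts := by
  obtain ⟨w, hw, rfl⟩ := hab
  exact ⟨h.base_mem_verts (h.mem_of_parent hw).2, (h.mem_of_parent hw).1⟩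

theorem anc_mem (h : SearchInv M σ) {a b : V} (hab : σ.Anc a b) (hb : b ∈ σ.verts) :
    a ∈ σ.verts := by
  rcases Relation.ReflTransGen.cases_head hab with rfl | ⟨c, hac, -⟩
  · exact hb
  · exact (h.nodeParent_mem hac).1

theorem nodeParent_unique {a a' b : V} (hab : σ.NodeParent a b)
    (hab' : σ.NodeParent a' b) : a = a' := by
  obtain ⟨w, hw, rfl⟩ := hab
  obtain ⟨w', hw', rfl⟩ := hab'
  rw [hw] at hw'
  rw [Option.some_inj.1 hw']

theorem acyclic (h : SearchInv M σ) {a b : V} (hab : σ.Anc a b) (hba : σ.NodeParent b a) :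
    False := by
  obtain ⟨r, hr, hr'⟩ := h.rank
  have h1 : ∀ {a b}, σ.NodeParent a b → r a < r b := by
    rintro a b ⟨w, hw, rfl⟩
    exact (hr' w).trans_lt (hr _ _ hw)
  have h2 : ∀ {b}, σ.Anc a b → r a ≤ r b := by
    intro b hab
    induction hab with
    | refl => exact le_rfl
    | tail _ hbc ih => exact ih.trans (h1 hbc).le
  exact absurd (h1 hba) (h2 hab).not_gt

theorem anc_antisymm (h : SearchInv M σ) {a b : V} (hab : σ.Anc a b) (hba : σ.Anc b a) :
    a = b := by
  rcases Relation.ReflTransGen.cases_tail hba with rfl | ⟨c, hbc, hca⟩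
  · rfl
  · exact (h.acyclic (hab.trans hbc) hca).elim

/-- The child of an odd vertex in the contracted search structure. -/
theorem nodeParent_of_odd (h : SearchInv M σ) {u c : V} (hu : u ∉ σ.even)
    (huc : σ.NodeParent u c) : σ.parent c = some u ∧ M.Adj u c ∧ c ∈ σ.even ∧ σ.base c = c := by
  obtain ⟨w, hw, hwu⟩ := huc
  obtain rfl := h.base_eq_of_not_even hu hwu
  exact ⟨hw, h.child_of_odd hw hu⟩

theorem matched_of_nodeParent (h : SearchInv M σ) {a c : V} (hc : c ∈ σ.even)
    (hac : σ.NodeParent a c) : c ∈ M.verts := by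
  by_contra hf
  obtain ⟨w, hw, -⟩ := hac
  rw [(h.free_even hc hf).2.1] at hw
  cases hw

/-- The canonical path of an even vertex stays on the path of the contracted search structure from
the root. -/
theorem anc_of_mem_path (h : SearchInv M σ) {v z : V} (hv : v ∈ σ.even) (hz : z ∈ σ.path v) :
    σ.Anc (σ.base z) (σ.base v) := by
  induction hn : (σ.path v).length using Nat.strong_induction_on generalizing v with
  | _ n ih =>
  subst hn
  obtain ⟨R, hR, hRb⟩ := h.path_eq hv
  rw [hR, List.mem_append] at hz
  rcases hz with hz | hz
  swap
  · rw [hRb z hz]; exact .refl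
  by_cases hf : σ.base v ∈ M.verts
  · obtain ⟨u, w, hu, huv, hue, hw, hwe, hP⟩ :=
      h.parent_of_base (h.base_mem_even hv) hf (h.base_base v)
    have hub := h.base_of_not_even hue
    have huv' : σ.NodeParent u (σ.base v) := ⟨u, hu, hub⟩
    rw [hP, List.mem_append] at hz
    rcases hz with hz | hz
    · refine ((ih _ ?_ hwe hz rfl).tail ⟨w, hw, rfl⟩).tail huv'
      rw [hR, hP]; simp
    · simp only [List.mem_cons, List.not_mem_nil, or_false] at hz
      rcases hz with rfl | rfl
      · rw [hub]; exact .single huv'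
      · rw [h.base_base]; exact .refl
  · rw [(h.free_even (h.base_mem_even hv) hf).2.2, List.mem_singleton] at hz
    rw [hz, h.base_base]; exact .refl

/-- The canonical path of an even vertex passes through the bases of the even nodes above it, and
from there on it stays below them. -/
theorem path_eq_of_anc (h : SearchInv M σ) {v c : V} (hv : v ∈ σ.even) (hc : c ∈ σ.even)
    (hcv : σ.Anc c (σ.base v)) :
    ∃ R, σ.path v = σ.path c ++ R ∧ ∀ z ∈ R, σ.Anc c (σ.base z) := by
  induction hn : (σ.path v).length using Nat.strong_induction_on generalizing v with
  | _ n ih =>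
  subst hn
  obtain ⟨R, hR, hRb⟩ := h.path_eq hv
  rcases Relation.ReflTransGen.cases_tail hcv with hcv' | ⟨d, hcd, hdv⟩
  · rw [hcv'] at hR
    exact ⟨R, hR, fun z hz => by rw [hRb z hz, hcv']; exact .refl⟩
  · obtain ⟨u, w, hu, huv, hue, hw, hwe, hP⟩ := h.parent_of_base (h.base_mem_even hv)
      (h.matched_of_nodeParent (h.base_mem_even hv) hdv) (h.base_base v)
    have hub := h.base_of_not_even hue
    have huv' : σ.NodeParent u (σ.base v) := ⟨u, hu, hub⟩
    have hwu : σ.NodeParent (σ.base w) u := ⟨w, hw, rfl⟩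
    obtain rfl := nodeParent_unique hdv huv'
    rcases Relation.ReflTransGen.cases_tail hcd with rfl | ⟨d, hcd', hdu⟩
    · exact (hue hc).elim
    obtain rfl := nodeParent_unique hdu hwu
    obtain ⟨R', hR', hRc⟩ := ih _ (by rw [hR, hP]; simp) hwe hcd' rfl
    refine ⟨R' ++ [d, σ.base v] ++ R, by rw [hR, hP, hR']; simp, ?_⟩
    intro z hz
    simp only [List.mem_append, List.mem_cons, List.not_mem_nil, or_false] at hz
    rcases hz with (hz | rfl | rfl) | hz
    · exact hRc z hz
    · rw [hub]; exact hcd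
    · rw [h.base_base]; exact hcv
    · rw [hRb z hz]; exact hcv

/-- The canonical path of an even vertex passes through the odd nodes above it: up to the parent
of such a node it is the canonical path of that parent, from the node on it stays below it. -/
theorem path_eq_of_odd_anc (h : SearchInv M σ) {v u : V} (hv : v ∈ σ.even) (hu : u ∉ σ.even)
    (huv : σ.Anc u (σ.base v)) :
    ∃ w S, σ.parent u = some w ∧ w ∈ σ.even ∧ σ.path v = σ.path w ++ u :: S ∧
      ∀ z ∈ u :: S, σ.Anc u (σ.base z) := by
  rcases Relation.ReflTransGen.cases_head huv with rfl | ⟨c, huc, hcv⟩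
  · exact (hu (h.base_mem_even hv)).elim
  obtain ⟨hcu, hM, hc, hcb⟩ := h.nodeParent_of_odd hu huc
  obtain ⟨u', w, hu', -, hue, hw, hwe, hP⟩ := h.parent_of_base hc hM.snd_mem hcb
  obtain rfl : u = u' := by rw [hcu] at hu'; exact Option.some_inj.1 hu'
  obtain ⟨R, hR, hRc⟩ := h.path_eq_of_anc hv hc hcv
  refine ⟨w, c :: R, hw, hwe, by rw [hR, hP]; simp, ?_⟩
  intro z hz
  simp only [List.mem_cons] at hz
  rcases hz with rfl | rfl | hz
  · rw [h.base_of_not_even hu]; exact .refl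
  · rw [hcb]; exact .single huc
  · exact .head huc (hRc z hz)

end SearchInv

/-! ### Tree paths -/

namespace State.IsTreePath

variable {σ : State V} {p : List V} {a b : V}

theorem left_mem (hp : σ.IsTreePath p a b) : a ∈ p := List.mem_of_head? hp.1

theorem right_mem (hp : σ.IsTreePath p a b) : b ∈ p := List.mem_of_getLast? hp.2.1

theorem pairwise (hp : σ.IsTreePath p a b) : p.Pairwise σ.Anc := by
  have h := hp.2.2.imp (S := σ.Anc) fun _ _ h => Relation.ReflTransGen.single h
  have : IsTrans V σ.Anc := ⟨fun _ _ _ h h' => Relation.ReflTransGen.trans h h'⟩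
  exact h.pairwise

theorem eq_or_nodeParent_left (hp : σ.IsTreePath p a b) {z : V} (hz : z ∈ p) :
    z = a ∨ ∃ d ∈ p, σ.NodeParent d z := by
  obtain ⟨h1, -, h3⟩ := hp
  induction p generalizing a with
  | nil => cases hz
  | cons a' p ih =>
    obtain rfl : a' = a := by simpa using h1
    rcases List.mem_cons.1 hz with rfl | hz
    · exact .inl rfl
    cases p with
    | nil => cases hz
    | cons c p =>
      rw [List.isChain_cons_cons] at h3
      rcases ih (a := c) hz rfl h3.2 with rfl | ⟨d, hd, hdz⟩
      · exact .inr ⟨a', by simp, h3.1⟩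
      · exact .inr ⟨d, List.mem_cons_of_mem _ hd, hdz⟩

theorem eq_or_nodeParent_right (hp : σ.IsTreePath p a b) {z : V} (hz : z ∈ p) :
    z = b ∨ ∃ d ∈ p, σ.NodeParent z d := by
  obtain ⟨-, h2, h3⟩ := hp
  induction p with
  | nil => cases hz
  | cons a' p ih =>
    cases p with
    | nil =>
      obtain rfl : a' = b := by simpa using h2
      exact .inl (by simpa using hz)
    | cons c p =>
      rw [List.isChain_cons_cons] at h3
      rcases List.mem_cons.1 hz with rfl | hz
      · exact .inr ⟨c, by simp, h3.1⟩
      rcases ih hz (by simpa using h2) h3.2 with rfl | ⟨d, hd, hdz⟩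
      · exact .inl rfl
      · exact .inr ⟨d, List.mem_cons_of_mem _ hd, hdz⟩

theorem anc_left (hp : σ.IsTreePath p a b) {z : V} (hz : z ∈ p) : σ.Anc a z := by
  have h := hp.pairwise
  obtain ⟨h1, -⟩ := hp
  cases p with
  | nil => cases hz
  | cons c p =>
    obtain rfl : c = a := by simpa using h1
    rcases List.mem_cons.1 hz with rfl | hz
    · exact .refl
    · exact (List.pairwise_cons.1 h).1 z hz

theorem anc_right (hp : σ.IsTreePath p a b) {z : V} (hz : z ∈ p) : σ.Anc z b := by
  have h := hp.pairwise
  obtain ⟨-, h2, -⟩ := hp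
  obtain ⟨q, rfl⟩ := List.getLast?_eq_some_iff.1 h2
  rw [List.mem_append, List.mem_singleton] at hz
  rcases hz with hz | rfl
  · exact (List.pairwise_append.1 h).2.2 z hz b (by simp)
  · exact .refl

variable {M : H.Subgraph}

/-- A tree path is closed under parents, up to its top. -/
theorem mem_of_nodeParent (hp : σ.IsTreePath p a b) {c z : V}
    (hz : z ∈ p) (hza : z ≠ a) (hcz : σ.NodeParent c z) : c ∈ p := by
  rcases hp.eq_or_nodeParent_left hz with h | ⟨d, hd, hdz⟩
  · exact (hza h).elim
  · rwa [SearchInv.nodeParent_unique hcz hdz]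

theorem mem_of_anc (hp : σ.IsTreePath p a b) (h : SearchInv M σ) {c : V} (hac : σ.Anc a c)
    (hcb : σ.Anc c b) : c ∈ p := by
  have key : ∀ {d}, σ.Anc c d → d ∈ p → c ∈ p := by
    intro d hcd
    induction hcd with
    | refl => exact id
    | @tail d e hcd hde ih =>
      intro he
      by_cases hea : e = a
      · subst hea
        exact (h.acyclic (hac.trans hcd) hde).elim
      · exact ih (hp.mem_of_nodeParent he hea hde)
  exact key hcb hp.right_mem

end State.IsTreePath

/-- Conversely, a proper descendant is the end of a tree path. -/
theorem State.IsProperDescendant.exists_isTreePath {σ : State V} {a b : V}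
    (h : σ.IsProperDescendant b a) : ∃ p, σ.IsTreePath p a b := by
  obtain ⟨l, hl⟩ := List.exists_isChain_cons_of_relationReflTransGen h.to_reflTransGen
  exact ⟨a :: l, rfl, by rw [List.getLast?_eq_some_getLast (List.cons_ne_nil a l), hl.2], hl.1⟩

/-! ### Growth of the search structure -/

namespace SearchInv

variable {M : H.Subgraph} {σ : State V}

open Classical in
theorem addRoot (h : SearchInv M σ) {f : V} (hf : IsFree M f) (hfS : f ∉ σ.verts) :
    SearchInv M (σ.addRoot f) := by
  have hfe : f ∉ σ.even := fun h' => hfS (h.even_subset h')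
  have hfb := h.base_of_not_mem hfS
  have hfp := h.parent_of_not_mem hfS
  have hne : ∀ {v}, v ∈ σ.even → v ≠ f := fun hv hvf => hfe (hvf ▸ hv)
  have hP : ∀ {v}, v ∈ σ.even → (σ.addRoot f).path v = σ.path v := fun hv =>
    Function.update_of_ne (hne hv) _ _
  have hPf : (σ.addRoot f).path f = [f] := by simp [State.addRoot]
  refine ⟨?_, ?_, ?_, ?_, h.base_base, h.rank, ?_, ?_, ?_, ?_, ?_, ?_, ?_, ?_, ?_⟩
  · exact Set.insert_subset_insert h.even_subset
  · exact fun hv => ⟨.inr (h.mem_of_parent hv).1, .inr (h.mem_of_parent hv).2⟩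
  · exact fun hv => h.base_of_not_even fun h' => hv (.inr h')
  · rintro v (rfl | hv)
    · exact .inl hfb
    · exact .inr (h.base_mem_even hv)
  · intro v w hv hw
    obtain ⟨h1, h2, h3⟩ := h.child_of_odd hv fun h' => hw (.inr h')
    exact ⟨h1, .inr h2, h3⟩
  · rintro v (rfl | hv) hM hb
    · exact (hf hM).elim
    · obtain ⟨u, w, hu, huv, hue, hw, hwe, hP'⟩ := h.parent_of_base hv hM hb
      refine ⟨u, w, hu, huv, ?_, hw, .inr hwe, by rw [hP hv, hP hwe, hP']⟩
      rintro (rfl | h')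
      · exact hf huv.fst_mem
      · exact hue h'
  · rintro v v' (rfl | hv) hb hM
    · exact (hb hfb).elim
    · exact h.base_mate hv hb hM
  · rintro u v (rfl | hu) hue huv
    · exact (hue (.inl rfl)).elim
    · obtain ⟨h1, h2, h3⟩ := h.mate_of_odd hu (fun h' => hue (.inr h')) huv
      exact ⟨.inr h1, h2, h3⟩
  · rintro v (rfl | hv) hvf
    · exact ⟨hfb, hfp, hPf⟩
    · rw [hP hv]
      exact h.free_even hv hvf
  · rintro v v' hM (rfl | hv)
    · exact (hf hM.fst_mem).elim
    · exact .inr (h.mate_mem hM hv)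
  · rintro v (rfl | hv)
    · exact ⟨[], by change _ = (σ.addRoot v).path (σ.base v) ++ _; rw [hfb]; simp, by simp⟩
    · obtain ⟨R, hR, hRb⟩ := h.path_eq hv
      refine ⟨R, ?_, hRb⟩
      change _ = (σ.addRoot f).path (σ.base v) ++ _
      rw [hP hv, hP (h.base_mem_even hv), hR]
  · rintro v (rfl | hv)
    · rw [hPf]; exact .singleton hf
    · rw [hP hv]; exact h.isEvenPath hv
  · rintro v (rfl | hv)
    · rw [hPf]; rintro z hz; exact .inl (by simpa using hz)
    · rw [hP hv]; exact fun z hz => .inr (h.path_subset hv z hz)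

open Classical in
theorem augment (h : SearchInv M σ) {x y : V} (hx : x ∈ σ.even) (hy : IsFree M y)
    (hyS : y ∉ σ.verts) : SearchInv M (σ.augment x y) := by
  have hye : y ∉ σ.even := fun h' => hyS (h.even_subset h')
  have hyb := h.base_of_not_mem hyS
  have hpy : (σ.augment x y).parent y = some x := by simp [State.augment]
  have hp : ∀ {v}, v ≠ y → (σ.augment x y).parent v = σ.parent v := fun hv =>
    Function.update_of_ne hv _ _
  have hne : ∀ {v}, v ∈ σ.even → v ≠ y := fun hv hvf => hye (hvf ▸ hv)
  obtain ⟨r, hr, hr'⟩ := h.rank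
  refine ⟨h.even_subset.trans (Set.subset_insert _ _), ?_, h.base_of_not_even, h.base_mem_even,
    h.base_base, ⟨Function.update r y (r x + 1), ?_, ?_⟩, ?_, ?_, h.base_mate, ?_, ?_, ?_,
    h.path_eq, h.isEvenPath, ?_⟩
  · intro v w hv
    by_cases hvy : v = y
    · subst hvy
      rw [hpy] at hv
      cases hv
      exact ⟨.inl rfl, .inr (h.even_subset hx)⟩
    · rw [hp hvy] at hv
      exact ⟨.inr (h.mem_of_parent hv).1, .inr (h.mem_of_parent hv).2⟩
  · intro v w hv
    by_cases hvy : v = y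
    · subst hvy
      rw [hpy] at hv
      cases hv
      rw [Function.update_self, Function.update_of_ne (hne hx)]
      exact Nat.lt_succ_self _
    · rw [hp hvy] at hv
      rw [Function.update_of_ne hvy, Function.update_of_ne]
      · exact hr _ _ hv
      · rintro rfl; exact hyS (h.mem_of_parent hv).2
  · intro v
    change Function.update r y (r x + 1) (σ.base v) ≤ _
    by_cases hvy : v = y
    · rw [hvy, hyb]
    · rw [Function.update_of_ne hvy, Function.update_of_ne]
      · exact hr' v
      · intro hvy'
        exact hvy (h.base_eq_of_not_even hye hvy')
  · intro v w hv hw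
    by_cases hvy : v = y
    · subst hvy
      rw [hpy] at hv
      cases hv
      exact (hw hx).elim
    · rw [hp hvy] at hv
      exact h.child_of_odd hv hw
  · intro v hv hM hb
    obtain ⟨u, w, hu, huv, hue, hw, hwe, hP'⟩ := h.parent_of_base hv hM hb
    refine ⟨u, w, by rwa [hp (hne hv)], huv, hue, ?_, hwe, hP'⟩
    rwa [hp]
    rintro rfl
    exact hy huv.fst_mem
  · rintro u v (rfl | hu) hue huv
    · exact (hy huv.fst_mem).elim
    · obtain ⟨h1, h2, h3⟩ := h.mate_of_odd hu hue huv
      exact ⟨h1, h2, by rwa [hp (hne h1)]⟩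
  · intro v hv hvf
    rw [hp (hne hv)]
    exact h.free_even hv hvf
  · rintro v v' hM (rfl | hv)
    · exact (hy hM.fst_mem).elim
    · exact .inr (h.mate_mem hM hv)
  · exact fun hv z hz => .inr (h.path_subset hv z hz)

open Classical in
theorem grow (hMm : M.IsMatching) (h : SearchInv M σ) {x y y' : V} (hx : x ∈ σ.even)
    (hxy : H.Adj x y) (hxy' : ¬ M.Adj x y) (hyS : y ∉ σ.verts) (hM : M.Adj y y') :
    SearchInv M (σ.grow x y y') := by
  have hy'S : y' ∉ σ.verts := fun h' => hyS (h.mate_mem hM.symm h')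
  have hxS := h.even_subset hx
  have hye : y ∉ σ.even := fun h' => hyS (h.even_subset h')
  have hy'e : y' ∉ σ.even := fun h' => hy'S (h.even_subset h')
  have hyb := h.base_of_not_mem hyS
  have hy'b := h.base_of_not_mem hy'S
  have hyy' : y ≠ y' := hM.ne
  have hyE : y ∉ (σ.grow x y y').even := by rintro (h' | h'); exacts [hyy' h', hye h']
  have hpy' : (σ.grow x y y').parent y' = some y := by simp [State.grow]
  have hpy : (σ.grow x y y').parent y = some x := by
    simp only [State.grow]
    rw [Function.update_of_ne hyy', Function.update_self]
  have hp : ∀ {v}, v ∈ σ.verts → (σ.grow x y y').parent v = σ.parent v := by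
    intro v hv
    simp only [State.grow]
    rw [Function.update_of_ne, Function.update_of_ne]
    all_goals rintro rfl; contradiction
  have hpS : ∀ {v w}, (σ.grow x y y').parent v = some w →
      v = y ∧ w = x ∨ v = y' ∧ w = y ∨ v ∈ σ.verts ∧ σ.parent v = some w := by
    intro v w hv
    by_cases h1 : v = y'
    · subst h1; rw [hpy'] at hv; cases hv; simp
    by_cases h2 : v = y
    · subst h2; rw [hpy] at hv; cases hv; simp
    have : σ.parent v = some w := by
      simp only [State.grow] at hv
      rwa [Function.update_of_ne h1, Function.update_of_ne h2] at hv
    exact .inr (.inr ⟨(h.mem_of_parent this).1, this⟩)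
  have hP : ∀ {v}, v ∈ σ.even → (σ.grow x y y').path v = σ.path v := fun hv =>
    Function.update_of_ne (ne_of_mem_of_not_mem hv hy'e) _ _
  have hPy' : (σ.grow x y y').path y' = σ.path x ++ [y, y'] := by
    simp [State.grow]
  obtain ⟨r, hr, hr'⟩ := h.rank
  refine ⟨?_, ?_, ?_, ?_, h.base_base,
    ⟨Function.update (Function.update r y (r x + 1)) y' (r x + 2), ?_, ?_⟩,
    ?_, ?_, ?_, ?_, ?_, ?_, ?_, ?_, ?_⟩
  · rintro v (rfl | hv)
    exacts [.inr (.inl rfl), .inr (.inr (h.even_subset hv))]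
  · intro v w hv
    rcases hpS hv with ⟨rfl, rfl⟩ | ⟨rfl, rfl⟩ | ⟨-, hv⟩
    · exact ⟨.inl rfl, .inr (.inr hxS)⟩
    · exact ⟨.inr (.inl rfl), .inl rfl⟩
    · exact ⟨.inr (.inr (h.mem_of_parent hv).1), .inr (.inr (h.mem_of_parent hv).2)⟩
  · exact fun hv => h.base_of_not_even fun h' => hv (.inr h')
  · rintro v (rfl | hv)
    · exact .inl hy'b
    · exact .inr (h.base_mem_even hv)
  · have hold : ∀ {v}, v ∈ σ.verts →
        Function.update (Function.update r y (r x + 1)) y' (r x + 2) v = r v := by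
      intro v hv
      rw [Function.update_of_ne, Function.update_of_ne]
      all_goals rintro rfl; contradiction
    intro v w hv
    rcases hpS hv with ⟨rfl, rfl⟩ | ⟨rfl, rfl⟩ | ⟨hvS, hv⟩
    · rw [hold hxS, Function.update_of_ne hyy', Function.update_self]; omega
    · rw [Function.update_self, Function.update_of_ne hyy', Function.update_self]; omega
    · rw [hold hvS, hold (h.mem_of_parent hv).2]
      exact hr _ _ hv
  · intro v
    simp only [State.grow]
    by_cases hv : v ∈ σ.verts
    · have hbv := h.base_mem_verts hv
      rw [Function.update_of_ne, Function.update_of_ne, Function.update_of_ne,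
        Function.update_of_ne]
      · exact hr' v
      all_goals intro h'
      · exact hyS (h' ▸ hv)
      · exact hy'S (h' ▸ hv)
      · exact hyS (h' ▸ hbv)
      · exact hy'S (h' ▸ hbv)
    · rw [h.base_of_not_mem hv]
  · intro v w hv hw
    rcases hpS hv with ⟨rfl, rfl⟩ | ⟨rfl, rfl⟩ | ⟨hvS, hv⟩
    · exact (hw (.inr hx)).elim
    · exact ⟨hM, .inl rfl, hy'b⟩
    · obtain ⟨h1, h2, h3⟩ := h.child_of_odd hv fun h' => hw (.inr h')
      exact ⟨h1, .inr h2, h3⟩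
  · rintro v (rfl | hv) hvM hb
    · exact ⟨y, x, hpy', hM, hyE, hpy, .inr hx, by rw [hPy', hP hx]⟩
    · obtain ⟨u, w, hu, huv, hue, hw, hwe, hP'⟩ := h.parent_of_base hv hvM hb
      have huS := (h.mem_of_parent hw).1
      refine ⟨u, w, by rwa [hp (h.even_subset hv)], huv, ?_, by rwa [hp huS], .inr hwe,
        by rw [hP hv, hP hwe, hP']⟩
      rintro (rfl | h')
      exacts [hy'S huS, hue h']
  · rintro v v' (rfl | hv) hb hvM
    · exact (hb hy'b).elim
    · exact h.base_mate hv hb hvM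
  · rintro u v (rfl | rfl | hu) hue huv
    · obtain rfl := hMm.eq_of_adj_left hM huv
      exact ⟨.inl rfl, hy'b, hpy'⟩
    · exact (hue (.inl rfl)).elim
    · obtain ⟨h1, h2, h3⟩ := h.mate_of_odd hu (fun h' => hue (.inr h')) huv
      exact ⟨.inr h1, h2, by rwa [hp (h.even_subset h1)]⟩
  · rintro v (rfl | hv) hvf
    · exact (hvf hM.snd_mem).elim
    · rw [hP hv, hp (h.even_subset hv)]
      exact h.free_even hv hvf
  · rintro v v' hvM (rfl | rfl | hv)
    · rw [hMm.eq_of_adj_left hvM hM]; exact .inr (.inl rfl)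
    · rw [hMm.eq_of_adj_left hvM hM.symm]; exact .inl rfl
    · exact .inr (.inr (h.mate_mem hvM hv))
  · rintro v (rfl | hv)
    · exact ⟨[], by change _ = (σ.grow x y v).path (σ.base v) ++ _; rw [hy'b]; simp, by simp⟩
    · obtain ⟨R, hR, hRb⟩ := h.path_eq hv
      refine ⟨R, ?_, hRb⟩
      change _ = (σ.grow x y y').path (σ.base v) ++ _
      rw [hP hv, hP (h.base_mem_even hv), hR]
  · rintro v (rfl | hv)
    · rw [hPy']
      exact (h.isEvenPath hx).grow hxy hxy' hM (fun h' => hyS (h.path_subset hx _ h'))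
        (fun h' => hy'S (h.path_subset hx _ h'))
    · rw [hP hv]; exact h.isEvenPath hv
  · rintro v (rfl | hv)
    · rw [hPy']
      intro z hz
      simp only [List.mem_append, List.mem_cons, List.not_mem_nil, or_false] at hz
      rcases hz with hz | rfl | rfl
      exacts [.inr (.inr (h.path_subset hx z hz)), .inl rfl, .inr (.inl rfl)]
    · rw [hP hv]
      exact fun z hz => .inr (.inr (h.path_subset hv z hz))

end SearchInv

/-! ### Blossom steps -/

theorem State.mem_oddVerts {σ : State V} {p : List V} {u : V} :
    u ∈ σ.oddVerts p ↔ u ∈ p ∧ u ∉ σ.even := by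
  simp [State.oddVerts]

open Classical in
theorem State.suffixFrom_append {l s : List V} {u : V} (hu : u ∉ l) :
    State.suffixFrom (l ++ u :: s) u = u :: s := by
  rw [State.suffixFrom, List.dropWhile_append_of_pos]
  · simp
  · intro a ha
    simpa using fun h : a = u => hu (h ▸ ha)

section shrink

variable {σ : State V} {x y : V} {p : List V}

open Classical in
theorem State.shrink_base_of_mem {z : V} (hz : σ.base z ∈ p) :
    (σ.shrink x y p).base z = σ.base x := if_pos hz

open Classical in
theorem State.shrink_base_of_not_mem {z : V} (hz : σ.base z ∉ p) :
    (σ.shrink x y p).base z = σ.base z := if_neg hz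

open Classical in
theorem State.shrink_path_of_even {z : V} (hz : z ∈ σ.even) :
    (σ.shrink x y p).path z = σ.path z := if_neg fun h => (State.mem_oddVerts.1 h).2 hz

open Classical in
theorem State.shrink_path_of_odd {z : V} (hz : z ∈ σ.oddVerts p) :
    (σ.shrink x y p).path z = σ.path x ++ (State.suffixFrom (σ.path y) z).reverse := if_pos hz

end shrink

namespace SearchInv

variable {M : H.Subgraph} {σ : State V} {x y : V} {p : List V}

theorem mate_of_mem_oddVerts (h : SearchInv M σ) (hy : y ∈ σ.even)
    (hp : σ.IsTreePath p (σ.base x) (σ.base y)) {u : V} (hu : u ∈ σ.oddVerts p) :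
    ∃ d ∈ p, σ.NodeParent u d ∧ σ.parent d = some u ∧ M.Adj u d ∧ d ∈ σ.even ∧ σ.base d = d := by
  obtain ⟨hup, hue⟩ := State.mem_oddVerts.1 hu
  rcases hp.eq_or_nodeParent_right hup with rfl | ⟨d, hd, hud⟩
  · exact (hue (h.base_mem_even hy)).elim
  · exact ⟨d, hd, hud, h.nodeParent_of_odd hue hud⟩

/-- On the tree path of a blossom step, a base other than the top is preceded by its mate. -/
theorem mate_mem_oddVerts (hMm : M.IsMatching) (h : SearchInv M σ)
    (hp : σ.IsTreePath p (σ.base x) (σ.base y)) {v v' : V} (hv : v ∈ σ.even) (hvp : v ∈ p)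
    (hvx : v ≠ σ.base x) (hvb : σ.base v = v) (hM : M.Adj v v') : v' ∈ σ.oddVerts p := by
  obtain ⟨u, w, hu, huv, hue, -⟩ := h.parent_of_base hv hM.fst_mem hvb
  obtain rfl := hMm.eq_of_adj_left hM huv.symm
  exact State.mem_oddVerts.2
    ⟨hp.mem_of_nodeParent hvp hvx ⟨v', hu, h.base_of_not_even hue⟩, hue⟩

/-- The canonical paths that a blossom step creates. -/
theorem shrink_path (h : SearchInv M σ) (hy : y ∈ σ.even)
    (hp : σ.IsTreePath p (σ.base x) (σ.base y)) {u : V} (hu : u ∈ σ.oddVerts p) :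
    ∃ w S, σ.parent u = some w ∧ w ∈ σ.even ∧ σ.path y = σ.path w ++ u :: S ∧
      (∀ z ∈ u :: S, σ.Anc u (σ.base z) ∧ σ.base z ∈ p) ∧
      (σ.shrink x y p).path u = σ.path x ++ (u :: S).reverse := by
  obtain ⟨hup, hue⟩ := State.mem_oddVerts.1 hu
  obtain ⟨w, S, hw, hwe, hP, hS⟩ := h.path_eq_of_odd_anc hy hue (hp.anc_right hup)
  refine ⟨w, S, hw, hwe, hP, fun z hz => ⟨hS z hz, ?_⟩, ?_⟩
  · refine hp.mem_of_anc h ((hp.anc_left hup).trans (hS z hz)) (h.anc_of_mem_path hy ?_)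
    rw [hP]
    exact List.mem_append_right _ hz
  · rw [State.shrink_path_of_odd hu, hP, State.suffixFrom_append]
    intro hu'
    have := (h.isEvenPath hy).nodup
    rw [hP, List.nodup_append'] at this
    exact this.2.2 hu' (by simp)

/-- The canonical path of an even vertex is disjoint from the nodes below its blossom. -/
theorem not_mem_path_of_anc (h : SearchInv M σ) {a u z : V} (hx : x ∈ σ.even)
    (hau : σ.NodeParent a u) (hxa : σ.Anc (σ.base x) a) (hz : σ.Anc u (σ.base z)) :
    z ∉ σ.path x :=
  fun hz' => h.acyclic ((hz.trans (h.anc_of_mem_path hx hz')).trans hxa) hau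

theorem nodeParent_of_mem_oddVerts (h : SearchInv M σ) (hx : x ∈ σ.even)
    (hp : σ.IsTreePath p (σ.base x) (σ.base y)) {u : V} (hu : u ∈ σ.oddVerts p) :
    ∃ a, σ.NodeParent a u ∧ σ.Anc (σ.base x) a := by
  obtain ⟨hup, hue⟩ := State.mem_oddVerts.1 hu
  rcases hp.eq_or_nodeParent_left hup with rfl | ⟨a, hap, hau⟩
  · exact (hue (h.base_mem_even hx)).elim
  · exact ⟨a, hau, hp.anc_left hap⟩

/-- A blossom step preserves the invariant. The tree path contains the mate of each of its odd
vertices and of each of its nodes except the top, so that the new blossom is closed under mates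
except for its base; and it contains the node of every vertex of the canonical path of `y` below
the top, so that the new canonical paths stay inside the new blossom. -/
theorem shrink (hMm : M.IsMatching) (h : SearchInv M σ) (hx : x ∈ σ.even) (hy : y ∈ σ.even)
    (hxy : H.Adj x y) (hxy' : ¬ M.Adj x y) (hp : σ.IsTreePath p (σ.base x) (σ.base y)) :
    SearchInv M (σ.shrink x y p) := by
  have hβ := h.base_mem_even hx
  have hin : ∀ {z}, σ.base z ∈ p → (σ.shrink x y p).base z = σ.base x :=
    State.shrink_base_of_mem
  have hout : ∀ {z}, σ.base z ∉ p → (σ.shrink x y p).base z = σ.base z :=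
    State.shrink_base_of_not_mem
  have hcongr : ∀ {z z'}, σ.base z = σ.base z' →
      (σ.shrink x y p).base z = (σ.shrink x y p).base z' := by
    intro z z' hzz'
    by_cases hz : σ.base z ∈ p
    · rw [hin hz, hin (hzz' ▸ hz)]
    · rw [hout hz, hout (hzz' ▸ hz), hzz']
  have hodd : ∀ {z}, z ∈ σ.oddVerts p → (σ.shrink x y p).base z = σ.base x := by
    intro z hz
    obtain ⟨hz1, hz2⟩ := State.mem_oddVerts.1 hz
    exact hin (by rwa [h.base_of_not_even hz2])
  have hfix : ∀ {z}, σ.base z = z → (z ∈ p → z = σ.base x) → (σ.shrink x y p).base z = z := by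
    intro z hz hzp
    by_cases hz' : σ.base z ∈ p
    · rw [hin hz', hzp (hz ▸ hz')]
    · rw [hout hz', hz]
  have hP : ∀ {v}, v ∈ σ.even → (σ.shrink x y p).path v = σ.path v := State.shrink_path_of_even
  have hEout : ∀ {u}, u ∉ (σ.shrink x y p).even → u ∉ σ.even ∧ u ∉ p := fun hu =>
    ⟨fun h' => hu (.inl h'),
      fun h' => hu (.inr (State.mem_oddVerts.2 ⟨h', fun h'' => hu (.inl h'')⟩))⟩
  obtain ⟨r, hr, hr'⟩ := h.rank
  -- the new base, at the top of the tree path, has the least rank of the contracted nodes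
  have hrp : ∀ z ∈ p, r (σ.base x) ≤ r z := by
    intro z hz
    have := hp.anc_left hz
    induction this with
    | refl => exact le_rfl
    | @tail b c hb hbc ih =>
      obtain ⟨w, hw, rfl⟩ := hbc
      have h1 := hr _ _ hw
      have h2 := hr' w
      by_cases hc : c = σ.base x
      · rw [hc]
      · exact (ih (hp.mem_of_nodeParent hz hc ⟨w, hw, rfl⟩)).trans (by omega)
  refine ⟨?_, h.mem_of_parent, ?_, ?_, ?_, ⟨r, hr, ?_⟩, ?_, ?_, ?_, ?_, ?_, h.mate_mem, ?_, ?_, ?_⟩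
  · rintro v (hv | hv)
    · exact h.even_subset hv
    · obtain ⟨d, -, -, hd, -⟩ := h.mate_of_mem_oddVerts hy hp hv
      exact (h.mem_of_parent hd).2
  · intro v hv
    obtain ⟨hve, hvp⟩ := hEout hv
    have hvb := h.base_of_not_even hve
    exact hfix hvb fun h' => (hvp h').elim
  · rintro v (hv | hv)
    · by_cases hvp : σ.base v ∈ p
      · rw [hin hvp]; exact .inl hβ
      · rw [hout hvp]; exact .inl (h.base_mem_even hv)
    · rw [hodd hv]; exact .inl hβ
  · intro v
    by_cases hvp : σ.base v ∈ p
    · rw [hin hvp]; exact hfix (h.base_base x) fun _ => rfl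
    · rw [hout hvp, hcongr (h.base_base v), hout hvp]
  · intro v
    by_cases hvp : σ.base v ∈ p
    · rw [hin hvp]; exact (hrp _ hvp).trans (hr' v)
    · rw [hout hvp]; exact hr' v
  · intro v w hv hw
    obtain ⟨hwe, hwp⟩ := hEout hw
    obtain ⟨h1, h2, h3⟩ := h.child_of_odd hv hwe
    refine ⟨h1, .inl h2, hfix h3 fun hvp => by_contra fun hvx => hwp ?_⟩
    exact hp.mem_of_nodeParent hvp hvx ⟨w, hv, h.base_of_not_even hwe⟩
  · rintro v (hv | hv) hvM hvb
    swap
    · rw [hodd hv] at hvb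
      exact ((State.mem_oddVerts.1 hv).2 (hvb ▸ hβ)).elim
    have hvb' : σ.base v = v ∧ (v ∈ p → v = σ.base x) := by
      by_cases hvp : σ.base v ∈ p
      · rw [hin hvp] at hvb
        subst hvb
        exact ⟨h.base_base x, fun _ => rfl⟩
      · rw [hout hvp] at hvb
        exact ⟨hvb, fun h' => (hvp (hvb.symm ▸ h')).elim⟩
    obtain ⟨u, w, hu, huv, hue, hw, hwe, hPv⟩ := h.parent_of_base hv hvM hvb'.1
    refine ⟨u, w, hu, huv, ?_, hw, .inl hwe, by rw [hP hv, hP hwe, hPv]⟩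
    rintro (h' | h')
    · exact hue h'
    · obtain ⟨d, hd, hud, -, hM', -⟩ := h.mate_of_mem_oddVerts hy hp h'
      obtain rfl := hMm.eq_of_adj_left huv hM'
      rw [hvb'.2 hd] at hud
      exact h.acyclic (hp.anc_left (State.mem_oddVerts.1 h').1) hud
  · rintro v v' (hv | hv) hvb hM
    · by_cases hb : σ.base v = v
      · have hvp : σ.base v ∈ p := by_contra fun hvp => hvb ((hout hvp).trans hb)
        have hvx : v ≠ σ.base x := by
          rw [hin hvp] at hvb; exact hvb.symm
        rw [hin hvp, hodd (h.mate_mem_oddVerts hMm hp hv (hb ▸ hvp) hvx hb hM)]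
      · exact hcongr (h.base_mate hv hb hM)
    · obtain ⟨d, hd, -, -, hM', -, hdb⟩ := h.mate_of_mem_oddVerts hy hp hv
      obtain rfl := hMm.eq_of_adj_left hM hM'
      rw [hodd hv, hin (by rwa [hdb])]
  · intro u v hu hue huv
    obtain ⟨hue', hup⟩ := hEout hue
    obtain ⟨h1, h2, h3⟩ := h.mate_of_odd hu hue' huv
    refine ⟨.inl h1, hfix h2 fun hvp => by_contra fun hvx => hup ?_, h3⟩
    exact hp.mem_of_nodeParent hvp hvx ⟨u, h3, h.base_of_not_even hue'⟩
  · rintro v (hv | hv) hvf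
    · obtain ⟨h1, h2, h3⟩ := h.free_even hv hvf
      refine ⟨hfix h1 fun hvp => by_contra fun hvx => ?_, h2, by rw [hP hv, h3]⟩
      rcases hp.eq_or_nodeParent_left hvp with h' | ⟨d, -, hdv⟩
      · exact hvx h'
      · exact hvf (h.matched_of_nodeParent hv hdv)
    · obtain ⟨d, -, -, -, hM', -⟩ := h.mate_of_mem_oddVerts hy hp hv
      exact (hvf hM'.fst_mem).elim
  · rintro v (hv | hv)
    · by_cases hvp : σ.base v ∈ p
      · rw [hin hvp, hP hv, hP hβ]
        obtain ⟨R, hR, hRc⟩ := h.path_eq_of_anc hv hβ (hp.anc_left hvp)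
        refine ⟨R, hR, fun z hz => hin (hp.mem_of_anc h (hRc z hz) ?_)⟩
        exact (h.anc_of_mem_path hv (hR ▸ List.mem_append_right _ hz)).trans (hp.anc_right hvp)
      · rw [hout hvp, hP hv, hP (h.base_mem_even hv)]
        obtain ⟨R, hR, hRb⟩ := h.path_eq hv
        exact ⟨R, hR, fun z hz => (hout (by rwa [hRb z hz])).trans (hRb z hz)⟩
    · obtain ⟨w, S, hw, hwe, hPy, hS, hPu⟩ := h.shrink_path hy hp hv
      obtain ⟨R, hR, hRb⟩ := h.path_eq hx
      rw [hodd hv, hPu, hP hβ, hR]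
      refine ⟨R ++ (v :: S).reverse, by simp, fun z hz => ?_⟩
      rcases List.mem_append.1 hz with hz | hz
      · exact hin (by rw [hRb z hz]; exact hp.left_mem)
      · exact hin (hS z (List.mem_reverse.1 hz)).2
  · rintro v (hv | hv)
    · rw [hP hv]; exact h.isEvenPath hv
    · -- the vertices taken from the path of `y` lie in nodes below that of `x`
      obtain ⟨w, S, hw, hwe, hPy, hS, hPu⟩ := h.shrink_path hy hp hv
      obtain ⟨a, hav, hxa⟩ := h.nodeParent_of_mem_oddVerts hx hp hv
      rw [hPu]
      refine (h.isEvenPath hx).blossom (hPy ▸ h.isEvenPath hy) (h.isEvenPath hwe) hxy hxy' ?_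
      exact fun z hz => h.not_mem_path_of_anc hx hav hxa (hS z hz).1
  · rintro v (hv | hv)
    · rw [hP hv]; exact h.path_subset hv
    · obtain ⟨w, S, hw, hwe, hPy, hS, hPu⟩ := h.shrink_path hy hp hv
      rw [hPu]
      intro z hz
      rcases List.mem_append.1 hz with hz | hz
      · exact h.path_subset hx z hz
      · refine h.path_subset hy z ?_
        rw [hPy]
        exact List.mem_append_right _ (List.mem_reverse.1 hz)

end SearchInv

/-! ### The recursion stack -/

/-- The vertices for which a call of `find_ap` is executing or still has to be made according to
a stack entry. -/
def Frame.verts : Frame V → List V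
  | .scan x _ => [x]
  | .calls us => us

/-- According to a stack entry, the edge `xy` still has to be scanned from `x`. -/
def Frame.Unscanned (x y : V) : Frame V → Prop
  | .scan x' E => x = x' ∧ y ∈ E
  | .calls us => x ∈ us

namespace State

/-- The vertices whose calls are executing or pending, the innermost first. -/
def active (σ : State V) : List V := σ.stack.flatMap Frame.verts

/-- The edge `xy` still has to be scanned from the even vertex `x`. -/
def Unscanned (σ : State V) (x y : V) : Prop := ∃ F ∈ σ.stack, F.Unscanned x y

/-- The edge `xy` has been scanned from `x`, where `x` lies on none of the collected paths. -/
def Scanned (M : H.Subgraph) (σ : State V) (x y : V) : Prop :=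
  x ∈ σ.even ∧ x ∉ σ.pathVerts ∧ H.Adj x y ∧ ¬ M.Adj x y ∧ ¬ σ.Unscanned x y

theorem Unscanned.mem_active {σ : State V} {x y : V} (h : σ.Unscanned x y) : x ∈ σ.active := by
  obtain ⟨F, hF, hxy⟩ := h
  refine List.mem_flatMap.2 ⟨F, hF, ?_⟩
  cases F with
  | scan x' E => exact List.mem_singleton.2 hxy.1
  | calls us => exact hxy

end State

/-- The collected paths and the free vertices, in relation to the search structure. -/
structure PathsInv (M : H.Subgraph) (σ : State V) : Prop where
  augmenting : ∀ p ∈ σ.paths, IsAugmentingPath M p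
  disjoint : ∀ p ∈ σ.paths, ∀ q ∈ σ.paths, p ≠ q → List.Disjoint p q
  subset : ∀ v ∈ σ.pathVerts, v ∈ σ.verts
  free_odd : ∀ v ∈ σ.verts, IsFree M v → v ∉ σ.even → v ∈ σ.pathVerts
  free_done : ∀ v, IsFree M v → v ∉ σ.todo → v ∈ σ.pathVerts ∨ v ∈ σ.even
  todo_free : ∀ v ∈ σ.todo, IsFree M v
  todo_not_even : ∀ v ∈ σ.todo, v ∉ σ.even

/-- The depth-first properties of the recursion. The active vertices lie on one root path of the
contracted search structure, and on one canonical path, so that their unscanned edges become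
irrelevant once that path is collected. -/
structure StackInv (M : H.Subgraph) (σ : State V) : Prop where
  active_even : ∀ v ∈ σ.active, v ∈ σ.even
  edges : ∀ x E, Frame.scan x E ∈ σ.stack → ∀ y ∈ E, H.Adj x y ∧ ¬ M.Adj x y
  active_anc : σ.active.Pairwise fun v w => σ.Anc (σ.base w) (σ.base v)
  active_path : σ.active.Pairwise fun v w => w ∈ σ.path v
  path_disjoint : ∀ v ∈ σ.active, ∀ z ∈ σ.path v, z ∉ σ.pathVerts
  not_anc : ∀ v ∈ σ.active, ∀ z ∈ σ.pathVerts, ¬ σ.Anc (σ.base v) (σ.base z)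
  scanned_mem : ∀ x y, σ.Scanned M x y → y ∈ σ.verts
  /-- An active node above the scanned vertex `y` is above `x` as well. Hence, when `y` becomes
  even later, the base of its new blossom is above `x`. -/
  scanned_anc : ∀ x y, σ.Scanned M x y → ∀ c ∈ σ.active, σ.Anc (σ.base c) (σ.base y) →
    σ.Anc (σ.base c) (σ.base x)
  /-- An edge that has been scanned from both ends lies in a blossom. -/
  scanned_base : ∀ x y, σ.Scanned M x y → σ.Scanned M y x → σ.base x = σ.base y

theorem PathsInv.init (M : H.Subgraph) : PathsInv M (init M) := by
  constructor <;> simp [MaxAugPaths.init, State.pathVerts]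

theorem StackInv.init (M : H.Subgraph) : StackInv M (init M) := by
  constructor <;> simp [MaxAugPaths.init, State.active, State.Scanned]

variable {M : H.Subgraph} {σ : State V}

theorem PathsInv.withStack (h : PathsInv M σ) (K : List (Frame V)) :
    PathsInv M { σ with stack := K } :=
  ⟨h.1, h.2, h.3, h.4, h.5, h.6, h.7⟩

theorem PathsInv.skipRoot (h : PathsInv M σ) {f : V} (hf : f ∈ σ.pathVerts) :
    PathsInv M { σ with todo := σ.todo \ {f} } := by
  refine ⟨h.1, h.2, h.3, h.4, fun v hv hvT => ?_, fun v hv => h.6 v hv.1, fun v hv => h.7 v hv.1⟩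
  by_cases hvf : v = f
  · exact .inl (hvf ▸ hf)
  · exact h.5 v hv fun h' => hvT ⟨h', hvf⟩

theorem PathsInv.not_mem_verts_of_todo (h : PathsInv M σ) {f : V} (hfT : f ∈ σ.todo)
    (hf : f ∉ σ.pathVerts) : f ∉ σ.verts :=
  fun h' => hf (h.free_odd f h' (h.todo_free f hfT) (h.todo_not_even f hfT))

theorem PathsInv.newRoot (h : PathsInv M σ) (f : V) (K : List (Frame V)) :
    PathsInv M { σ.addRoot f with todo := σ.todo \ {f}, stack := K } := by
  refine ⟨h.1, h.2, fun v hv => .inr (h.3 v hv), ?_, ?_, fun v hv => h.6 v hv.1, ?_⟩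
  · rintro v (rfl | hv) hvf hve
    · exact (hve (.inl rfl)).elim
    · exact h.4 v hv hvf fun h' => hve (.inr h')
  · intro v hv hvT
    by_cases hvf : v = f
    · exact .inr (.inl hvf)
    · exact (h.5 v hv fun h' => hvT ⟨h', hvf⟩).imp_right .inr
  · rintro v ⟨hv, hvf⟩ (h' | h')
    exacts [hvf h', h.7 v hv h']

theorem PathsInv.grow (h : PathsInv M σ) {x y y' : V} (hM : M.Adj y y') (K : List (Frame V)) :
    PathsInv M { σ.grow x y y' with stack := K } := by
  refine ⟨h.1, h.2, fun v hv => .inr (.inr (h.3 v hv)), ?_, ?_, h.6, ?_⟩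
  · rintro v (rfl | rfl | hv) hvf hve
    · exact (hvf hM.fst_mem).elim
    · exact (hvf hM.snd_mem).elim
    · exact h.4 v hv hvf fun h' => hve (.inr h')
  · exact fun v hv hvT => (h.5 v hv hvT).imp_right .inr
  · rintro v hv (rfl | h')
    exacts [h.6 _ hv hM.snd_mem, h.7 v hv h']

theorem PathsInv.shrink (h : PathsInv M σ) (hS : SearchInv M σ) {x y : V} {p : List V}
    (hy : y ∈ σ.even) (hp : σ.IsTreePath p (σ.base x) (σ.base y)) (K : List (Frame V)) :
    PathsInv M { σ.shrink x y p with stack := K } := by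
  refine ⟨h.1, h.2, h.3, ?_, ?_, h.6, ?_⟩
  · exact fun v hv hvf hve => h.4 v hv hvf fun h' => hve (.inl h')
  · exact fun v hv hvT => (h.5 v hv hvT).imp_right .inl
  · rintro v hv (h' | h')
    · exact h.7 v hv h'
    · obtain ⟨d, -, -, -, hM', -⟩ := hS.mate_of_mem_oddVerts hy hp h'
      exact h.6 v hv hM'.fst_mem

theorem State.mem_pathVerts_augment {x y z : V} :
    z ∈ (σ.augment x y).pathVerts ↔ z ∈ σ.path x ∨ z = y ∨ z ∈ σ.pathVerts := by
  simp [State.pathVerts, State.augment, or_assoc]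

theorem PathsInv.augment (h : PathsInv M σ) (hS : SearchInv M σ) {x y : V} (hx : x ∈ σ.even)
    (hxy : H.Adj x y) (hy : IsFree M y) (hyS : y ∉ σ.verts)
    (hdisj : ∀ z ∈ σ.path x, z ∉ σ.pathVerts) : PathsInv M (σ.augment x y) := by
  have hnew : ∀ q ∈ σ.paths, List.Disjoint (σ.path x ++ [y]) q := by
    intro q hq z hz hzq
    have hzC : z ∈ σ.pathVerts := ⟨q, hq, hzq⟩
    rcases List.mem_append.1 hz with hz | hz
    · exact hdisj z hz hzC
    · rw [List.mem_singleton.1 hz] at hzC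
      exact hyS (h.subset y hzC)
  refine ⟨?_, ?_, ?_, ?_, ?_, h.6, h.7⟩
  · rintro p (rfl | hp)
    · exact (hS.isEvenPath hx).isAugmentingPath hxy hy fun h' => hyS (hS.path_subset hx _ h')
    · exact h.1 p hp
  · rintro p (rfl | hp) q (rfl | hq) hpq
    · exact (hpq rfl).elim
    · exact hnew q hq
    · exact (hnew p hp).symm
    · exact h.2 p hp q hq hpq
  · intro v hv
    rcases State.mem_pathVerts_augment.1 hv with hv | rfl | hv
    · exact .inr (hS.path_subset hx v hv)
    · exact .inl rfl
    · exact .inr (h.3 v hv)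
  · rintro v (rfl | hv) hvf hve
    · exact State.mem_pathVerts_augment.2 (.inr (.inl rfl))
    · exact State.mem_pathVerts_augment.2 (.inr (.inr (h.4 v hv hvf hve)))
  · exact fun v hv hvT =>
      (h.5 v hv hvT).imp_left fun h' => State.mem_pathVerts_augment.2 (.inr (.inr h'))

namespace StackInv

/-- A change of the stack that adds no active vertex. The hypothesis `hK` is the claim of the last
three fields for the edges that become scanned. -/
theorem restack (h : StackInv M σ) {K : List (Frame V)}
    (hact : (K.flatMap Frame.verts).Sublist σ.active)
    (hedges : ∀ x E, Frame.scan x E ∈ K → ∀ y ∈ E, H.Adj x y ∧ ¬ M.Adj x y)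
    (hK : ∀ x y, H.Adj x y → ¬ M.Adj x y → σ.Unscanned x y →
      ¬ ({ σ with stack := K } : State V).Unscanned x y →
      y ∈ σ.verts ∧ (∀ c ∈ σ.active, σ.Anc (σ.base c) (σ.base y) → σ.Anc (σ.base c) (σ.base x)) ∧
        (({ σ with stack := K } : State V).Scanned M y x → σ.base x = σ.base y)) :
    StackInv M { σ with stack := K } := by
  have key : ∀ x y, ({ σ with stack := K } : State V).Scanned M x y → σ.Scanned M x y ∨
      y ∈ σ.verts ∧ (∀ c ∈ σ.active, σ.Anc (σ.base c) (σ.base y) → σ.Anc (σ.base c) (σ.base x)) ∧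
        (({ σ with stack := K } : State V).Scanned M y x → σ.base x = σ.base y) := by
    rintro x y ⟨h1, h2, h3, h4, h5⟩
    by_cases hu : σ.Unscanned x y
    · exact .inr (hK x y h3 h4 hu h5)
    · exact .inl ⟨h1, h2, h3, h4, hu⟩
  refine ⟨fun v hv => h.1 v (hact.subset hv), hedges, h.3.sublist hact, h.4.sublist hact,
    fun v hv => h.5 v (hact.subset hv), fun v hv => h.6 v (hact.subset hv), ?_, ?_, ?_⟩
  · intro x y hxy
    rcases key x y hxy with h' | h'
    exacts [h.7 x y h', h'.1]
  · intro x y hxy c hc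
    rcases key x y hxy with h' | h'
    exacts [h.8 x y h' c (hact.subset hc), h'.2.1 c (hact.subset hc)]
  · intro x y hxy hyx
    rcases key x y hxy with h' | h'
    · rcases key y x hyx with h'' | h''
      exacts [h.9 x y h' h'', (h''.2.2 hxy).symm]
    · exact h'.2.2 hyx

/-- Removal of the edge `xy` from the edges to be scanned by an executing call. -/
theorem removeEdge (h : StackInv M σ) {x y : V} {E : Set V} {L K : List (Frame V)}
    (hσ : σ.stack = L ++ .scan x E :: K) (hy : y ∈ σ.verts)
    (hanc : ∀ c ∈ σ.active, σ.Anc (σ.base c) (σ.base y) → σ.Anc (σ.base c) (σ.base x))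
    (hbase : σ.Scanned M y x → σ.base x = σ.base y) :
    StackInv M { σ with stack := L ++ .scan x (E \ {y}) :: K } := by
  have key : ∀ a b, σ.Unscanned a b →
      ({ σ with stack := L ++ .scan x (E \ {y}) :: K } : State V).Unscanned a b ∨
        a = x ∧ b = y := by
    rintro a b ⟨F, hF, hab⟩
    rw [hσ] at hF
    simp only [List.mem_append, List.mem_cons] at hF
    rcases hF with hF | rfl | hF
    · exact .inl ⟨F, by simp [hF], hab⟩
    · obtain ⟨rfl, hb⟩ := hab
      by_cases hby : b = y
      · exact .inr ⟨rfl, hby⟩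
      · exact .inl ⟨.scan a (E \ {y}), by simp, rfl, hb, hby⟩
    · exact .inl ⟨F, by simp [hF], hab⟩
  refine h.restack ?_ ?_ ?_
  · rw [State.active, hσ]
    simp [Frame.verts]
  · intro x' E' hE'
    simp only [List.mem_append, List.mem_cons, Frame.scan.injEq] at hE'
    rcases hE' with hE' | ⟨rfl, rfl⟩ | hE'
    · exact h.edges x' E' (by simp [hσ, hE'])
    · exact fun z hz => h.edges x' E (by simp [hσ]) z hz.1
    · exact h.edges x' E' (by simp [hσ, hE'])
  · intro a b hab _ hu hu'
    rcases key a b hu with h' | ⟨rfl, rfl⟩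
    · exact (hu' h').elim
    · refine ⟨hy, hanc, fun ⟨h1, h2, h3, h4, h5⟩ => hbase ⟨h1, h2, h3, h4, fun h6 => ?_⟩⟩
      rcases key _ _ h6 with h' | ⟨rfl, -⟩
      exacts [h5 h', hab.ne rfl]

theorem scanDone (h : StackInv M σ) {x : V} {K : List (Frame V)} (hσ : σ.stack = .scan x ∅ :: K) :
    StackInv M { σ with stack := K } := by
  refine h.restack ?_ (fun x' E' hE' => h.edges x' E' (by simp [hσ, hE'])) ?_
  · rw [State.active, hσ]
    simp [Frame.verts]
  · rintro a b - - ⟨F, hF, hab⟩ hu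
    rw [hσ, List.mem_cons] at hF
    rcases hF with rfl | hF
    · exact hab.2.elim
    · exact (hu ⟨F, hF, hab⟩).elim

theorem callsDone (h : StackInv M σ) {K : List (Frame V)} (hσ : σ.stack = .calls [] :: K) :
    StackInv M { σ with stack := K } := by
  refine h.restack ?_ (fun x' E' hE' => h.edges x' E' (by simp [hσ, hE'])) ?_
  · rw [State.active, hσ]
    simp [Frame.verts]
  · rintro a b - - ⟨F, hF, hab⟩ hu
    rw [hσ, List.mem_cons] at hF
    rcases hF with rfl | hF
    · cases hab
    · exact (hu ⟨F, hF, hab⟩).elim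

theorem callNext (h : StackInv M σ) {u : V} {us : List V} {K : List (Frame V)}
    (hσ : σ.stack = .calls (u :: us) :: K) :
    StackInv M { σ with stack := call M u :: .calls us :: K } := by
  refine h.restack ?_ ?_ ?_
  · rw [State.active, hσ]
    simp [Frame.verts, call]
  · intro x' E' hE'
    simp only [call, List.mem_cons, Frame.scan.injEq, reduceCtorEq, false_or] at hE'
    rcases hE' with ⟨rfl, rfl⟩ | hE'
    · exact fun z hz => hz
    · exact h.edges x' E' (by simp [hσ, hE'])
  · rintro a b hab hab' ⟨F, hF, hF'⟩ hu
    rw [hσ, List.mem_cons] at hF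
    refine (hu ?_).elim
    rcases hF with rfl | hF
    · rcases List.mem_cons.1 hF' with rfl | hF'
      · exact ⟨call M a, by simp, rfl, hab, hab'⟩
      · exact ⟨.calls us, by simp, hF'⟩
    · exact ⟨F, by simp [hF], hF'⟩

theorem withTodo (h : StackInv M σ) (T : Set V) : StackInv M { σ with todo := T } :=
  ⟨h.1, h.2, h.3, h.4, h.5, h.6, h.7, h.8, h.9⟩

/-- The other active vertices, in relation to the vertex of the innermost call. -/
theorem of_scan (h : StackInv M σ) (hS : SearchInv M σ) {x : V} {E : Set V} {K : List (Frame V)}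
    (hσ : σ.stack = .scan x E :: K) :
    x ∈ σ.active ∧ ∀ c ∈ σ.active, σ.Anc (σ.base c) (σ.base x) ∧ c ∈ σ.path x := by
  have hact : σ.active = x :: K.flatMap Frame.verts := by rw [State.active, hσ]; rfl
  have h1 := h.active_even
  have h3 := h.active_anc
  have h4 := h.active_path
  rw [hact] at h1 h3 h4 ⊢
  refine ⟨by simp, fun c hc => ?_⟩
  rcases List.mem_cons.1 hc with rfl | hc
  · exact ⟨.refl, (hS.isEvenPath (h1 c (by simp))).mem⟩
  · exact ⟨(List.pairwise_cons.1 h3).1 c hc, (List.pairwise_cons.1 h4).1 c hc⟩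

theorem skipEdge (h : StackInv M σ) (hS : SearchInv M σ) {x y : V} {E : Set V}
    {K : List (Frame V)} (hσ : σ.stack = .scan x E :: K) (hy : y ∈ σ.verts)
    (hskip : ¬ (σ.base y ∈ σ.even ∧ σ.IsProperDescendant (σ.base y) (σ.base x))) :
    StackInv M { σ with stack := .scan x (E \ {y}) :: K } := by
  obtain ⟨hx, htop⟩ := h.of_scan hS hσ
  refine h.removeEdge (L := []) hσ hy (fun c hc _ => (htop c hc).1) fun hyx => ?_
  have h1 := h.scanned_anc y x hyx x hx .refl
  rcases Relation.reflTransGen_iff_eq_or_transGen.1 h1 with h2 | h2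
  · exact h2.symm
  · exact (hskip ⟨hS.base_mem_even hyx.1, h2⟩).elim

theorem newRoot (h : StackInv M σ) (hS : SearchInv M σ) (hC : PathsInv M σ) {f : V}
    (hσ : σ.stack = []) (hfS : f ∉ σ.verts) (hf : f ∉ σ.pathVerts) (T : Set V) :
    StackInv M { σ.addRoot f with todo := T, stack := [call M f] } := by
  have hact : ∀ {v}, v ∈ ({ σ.addRoot f with todo := T, stack := [call M f] } : State V).active →
      v = f := by
    simp [State.active, call, Frame.verts]
  have hfb := hS.base_of_not_mem hfS
  have hpf : (σ.addRoot f).path f = [f] := by simp [State.addRoot]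
  have hnot : ∀ {z}, z ∈ σ.verts → ¬ σ.Anc (σ.base f) (σ.base z) := by
    intro z hz hfz
    rw [hfb] at hfz
    exact hfS (hS.anc_mem hfz (hS.base_mem_verts hz))
  have hold : ∀ {x y},
      ({ σ.addRoot f with todo := T, stack := [call M f] } : State V).Scanned M x y →
      σ.Scanned M x y := by
    rintro x y ⟨hx | hx, h2, h3, h4, h5⟩
    · exact (h5 ⟨call M f, by simp, hx, hx ▸ h3, hx ▸ h4⟩).elim
    · refine ⟨hx, h2, h3, h4, ?_⟩
      simp [State.Unscanned, hσ]
  refine ⟨?_, ?_, ?_, ?_, ?_, ?_, ?_, ?_, ?_⟩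
  · exact fun v hv => .inl (hact hv)
  · intro x E hE
    simp only [call, List.mem_singleton, Frame.scan.injEq] at hE
    obtain ⟨rfl, rfl⟩ := hE
    exact fun y hy => hy
  · exact List.pairwise_singleton _ _
  · exact List.pairwise_singleton _ _
  · intro v hv z hz
    rw [hact hv] at hz
    change z ∈ (σ.addRoot f).path f at hz
    rw [hpf, List.mem_singleton] at hz
    exact hz ▸ hf
  · intro v hv z hz
    rw [hact hv]
    exact hnot (hC.subset z hz)
  · exact fun x y hxy => .inr (h.scanned_mem x y (hold hxy))
  · intro x y hxy c hc hcy
    rw [hact hc] at hcy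
    exact (hnot (h.scanned_mem x y (hold hxy)) hcy).elim
  · exact fun x y hxy hyx => h.scanned_base x y (hold hxy) (hold hyx)

theorem augment (h : StackInv M σ) (hS : SearchInv M σ) {x y : V} {E : Set V}
    {K : List (Frame V)} (hσ : σ.stack = .scan x E :: K) : StackInv M (σ.augment x y) := by
  have hold : ∀ {a b}, (σ.augment x y).Scanned M a b → σ.Scanned M a b := by
    rintro a b ⟨h1, h2, h3, h4, -⟩
    rw [State.mem_pathVerts_augment, not_or, not_or] at h2
    -- an edge that was still to be scanned starts on the path collected now
    exact ⟨h1, h2.2.2, h3, h4, fun hu => h2.1 ((h.of_scan hS hσ).2 a hu.mem_active).2⟩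
  have hact : ∀ {v}, v ∉ (σ.augment x y).active := by
    simp [State.active, State.augment]
  refine ⟨fun v hv => (hact hv).elim, by simp [State.augment],
    by simp [State.active, State.augment],
    by simp [State.active, State.augment], fun v hv => (hact hv).elim, fun v hv => (hact hv).elim,
    fun a b hab => .inr (h.scanned_mem a b (hold hab)), fun a b _ c hc => (hact hc).elim,
    fun a b hab hba => h.scanned_base a b (hold hab) (hold hba)⟩

end StackInv

/-! ### Grow steps and the recursion stack -/

namespace SearchInv

open Classical in
theorem nodeParent_grow_iff {x y y' a b : V} (hyS : y ∉ σ.verts)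
    (hy'S : y' ∉ σ.verts) (hb : b ∈ σ.verts) :
    (σ.grow x y y').NodeParent a b ↔ σ.NodeParent a b := by
  have hp : (σ.grow x y y').parent b = σ.parent b := by
    simp only [State.grow]
    rw [Function.update_of_ne (ne_of_mem_of_not_mem hb hy'S),
      Function.update_of_ne (ne_of_mem_of_not_mem hb hyS)]
  unfold State.NodeParent
  rw [hp]
  rfl

theorem anc_grow_iff (h : SearchInv M σ) {x y y' a b : V} (hyS : y ∉ σ.verts)
    (hy'S : y' ∉ σ.verts) (hb : b ∈ σ.verts) :
    (σ.grow x y y').Anc a b ↔ σ.Anc a b := by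
  constructor <;> intro hab
  · induction hab with
    | refl => exact .refl
    | tail _ hbc ih =>
      rw [nodeParent_grow_iff hyS hy'S hb] at hbc
      exact (ih (h.nodeParent_mem hbc).1).tail hbc
  · induction hab with
    | refl => exact .refl
    | tail _ hbc ih =>
      exact (ih (h.nodeParent_mem hbc).1).tail ((nodeParent_grow_iff hyS hy'S hb).2 hbc)

end SearchInv

namespace StackInv

open Classical in
theorem grow (hMm : M.IsMatching) (h : StackInv M σ) (hS : SearchInv M σ) (hC : PathsInv M σ)
    {x y y' : V} {E : Set V} {K : List (Frame V)} (hσ : σ.stack = .scan x E :: K)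
    (hyE : y ∈ E) (hyS : y ∉ σ.verts) (hM : M.Adj y y') :
    StackInv M { σ.grow x y y' with stack := call M y' :: .scan x (E \ {y}) :: K } := by
  obtain ⟨hxA, htop⟩ := h.of_scan hS hσ
  have hx := h.active_even x hxA
  obtain ⟨hxy, hxy'⟩ := h.edges x E (by simp [hσ]) y hyE
  have hS' := hS.grow hMm hx hxy hxy' hyS hM
  have hy'S : y' ∉ σ.verts := fun h' => hyS (hS.mate_mem hM.symm h')
  have hy'e : y' ∉ σ.even := fun h' => hy'S (hS.even_subset h')
  have hyb := hS.base_of_not_mem hyS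
  have hy'b := hS.base_of_not_mem hy'S
  have hP : ∀ {v}, v ∈ σ.even → (σ.grow x y y').path v = σ.path v := fun hv =>
    Function.update_of_ne (ne_of_mem_of_not_mem hv hy'e) _ _
  have hPy' : (σ.grow x y y').path y' = σ.path x ++ [y, y'] := by simp [State.grow]
  have hanc : ∀ {a b}, b ∈ σ.verts → ((σ.grow x y y').Anc a (σ.base b) ↔ σ.Anc a (σ.base b)) :=
    fun hb => hS.anc_grow_iff hyS hy'S (hS.base_mem_verts hb)
  have hnot : ∀ {z}, z ∈ σ.verts → ¬ (σ.grow x y y').Anc (σ.base y') (σ.base z) := by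
    intro z hz hy'z
    rw [hanc hz, hy'b] at hy'z
    exact hy'S (hS.anc_mem hy'z (hS.base_mem_verts hz))
  have hxy_par : (σ.grow x y y').NodeParent (σ.base x) y :=
    ⟨x, by simp only [State.grow]; rw [Function.update_of_ne hM.ne, Function.update_self], rfl⟩
  have hyy'_par : (σ.grow x y y').NodeParent y y' := ⟨y, by simp [State.grow], hyb⟩
  have hactive : ({ σ.grow x y y' with stack := call M y' :: σ.stack } : State V).active =
    y' :: σ.active := rfl
  have hold : ∀ {a b},
      ({ σ.grow x y y' with stack := call M y' :: σ.stack } : State V).Scanned M a b →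
      σ.Scanned M a b := by
    rintro a b ⟨ha | ha, h2, h3, h4, h5⟩
    · exact (h5 ⟨call M y', by simp, ha, ha ▸ h3, ha ▸ h4⟩).elim
    · exact ⟨ha, h2, h3, h4, fun ⟨F, hF, hab⟩ => h5 ⟨F, List.mem_cons_of_mem _ hF, hab⟩⟩
  have hpush : StackInv M { σ.grow x y y' with stack := call M y' :: σ.stack } := by
    refine ⟨?_, ?_, ?_, ?_, ?_, ?_, ?_, ?_, ?_⟩
    · rw [hactive]
      intro v hv
      rcases List.mem_cons.1 hv with rfl | hv
      exacts [.inl rfl, .inr (h.active_even v hv)]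
    · intro a E' hE'
      simp only [call, List.mem_cons, Frame.scan.injEq] at hE'
      rcases hE' with ⟨rfl, rfl⟩ | hE'
      exacts [fun z hz => hz, h.edges a E' hE']
    · rw [hactive, List.pairwise_cons]
      refine ⟨fun c hc => ?_, h.active_anc.imp_of_mem fun ha _ hab => ?_⟩
      · change (σ.grow x y y').Anc (σ.base c) (σ.base y')
        rw [hy'b]
        exact (((hanc (hS.even_subset hx)).2 (htop c hc).1).tail hxy_par).tail hyy'_par
      · exact (hanc (hS.even_subset (h.active_even _ ha))).2 hab
    · rw [hactive, List.pairwise_cons]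
      refine ⟨fun c hc => ?_, h.active_path.imp_of_mem fun {a b} ha _ hab => ?_⟩
      · change c ∈ (σ.grow x y y').path y'
        rw [hPy']
        exact List.mem_append_left _ (htop c hc).2
      · change b ∈ (σ.grow x y y').path a
        rwa [hP (h.active_even a ha)]
    · rw [hactive]
      intro v hv z hz
      change z ∈ (σ.grow x y y').path v at hz
      rcases List.mem_cons.1 hv with rfl | hv
      · rw [hPy'] at hz
        simp only [List.mem_append, List.mem_cons, List.not_mem_nil, or_false] at hz
        rcases hz with hz | rfl | rfl
        · exact h.path_disjoint x hxA z hz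
        · exact fun h' => hyS (hC.subset z h')
        · exact fun h' => hy'S (hC.subset z h')
      · rw [hP (h.active_even v hv)] at hz
        exact h.path_disjoint v hv z hz
    · rw [hactive]
      intro v hv z hz
      change ¬ (σ.grow x y y').Anc (σ.base v) (σ.base z)
      rcases List.mem_cons.1 hv with rfl | hv
      · exact hnot (hC.subset z hz)
      · rw [hanc (hC.subset z hz)]
        exact h.not_anc v hv z hz
    · exact fun a b hab => .inr (.inr (h.scanned_mem a b (hold hab)))
    · rw [hactive]
      intro a b hab c hc hcb
      have hab' := hold hab
      have hb := h.scanned_mem a b hab'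
      rcases List.mem_cons.1 hc with rfl | hc
      · exact (hnot hb hcb).elim
      · exact (hanc (hS.even_subset hab'.1)).2 (h.scanned_anc a b hab' c hc ((hanc hb).1 hcb))
    · exact fun a b hab hba => h.scanned_base a b (hold hab) (hold hba)
  -- an ancestor of `y` other than `y` is above the parent of `y`, the node of `x`
  refine hpush.removeEdge (L := [call M y']) (by simp [hσ]) (.inl rfl) ?_ ?_
  · intro c hc hcy
    change (σ.grow x y y').Anc (σ.base c) (σ.base y) at hcy
    change (σ.grow x y y').Anc (σ.base c) (σ.base x)
    have hyE' : y ∉ (σ.grow x y y').even := by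
      rintro (h' | h')
      exacts [hM.ne h', hyS (hS.even_subset h')]
    rw [hyb] at hcy
    rcases Relation.ReflTransGen.cases_tail hcy with h' | ⟨d, hcd, hdy⟩
    · exact (hyE' (h' ▸ hS'.base_mem_even (hpush.active_even c hc))).elim
    · rwa [SearchInv.nodeParent_unique hdy hxy_par] at hcd
  · intro hyx
    rcases hyx.1 with h' | h'
    · exact (hM.ne h').elim
    · exact (hyS (hS.even_subset h')).elim

end StackInv

/-! ### Blossom steps and the recursion stack -/

namespace SearchInv

variable {x y : V} {p : List V}

theorem shrink_base_congr {z z' : V} (hzz' : σ.base z = σ.base z') :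
    (σ.shrink x y p).base z = (σ.shrink x y p).base z' := by
  by_cases hz : σ.base z ∈ p
  · rw [State.shrink_base_of_mem hz, State.shrink_base_of_mem (hzz' ▸ hz)]
  · rw [State.shrink_base_of_not_mem hz, State.shrink_base_of_not_mem (hzz' ▸ hz), hzz']

theorem anc_of_anc_shrink (hp : σ.IsTreePath p (σ.base x) (σ.base y)) {a b : V}
    (hab : (σ.shrink x y p).Anc a b) : σ.Anc a b := by
  induction hab with
  | refl => exact .refl
  | @tail b c _ hbc ih =>
    obtain ⟨w, hw, hwb⟩ := hbc
    by_cases hwp : σ.base w ∈ p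
    · rw [State.shrink_base_of_mem hwp] at hwb
      subst hwb
      exact (ih.trans (hp.anc_left hwp)).tail ⟨w, hw, rfl⟩
    · rw [State.shrink_base_of_not_mem hwp] at hwb
      exact ih.tail ⟨w, hw, hwb⟩

theorem anc_base_of_anc_shrink (hp : σ.IsTreePath p (σ.base x) (σ.base y)) {a z : V}
    (haz : (σ.shrink x y p).Anc a ((σ.shrink x y p).base z)) : σ.Anc a (σ.base z) := by
  have h1 := anc_of_anc_shrink hp haz
  by_cases hz : σ.base z ∈ p
  · rw [State.shrink_base_of_mem hz] at h1
    exact h1.trans (hp.anc_left hz)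
  · rwa [State.shrink_base_of_not_mem hz] at h1

/-- Contraction of a blossom preserves the ancestor relation between nodes. -/
theorem shrink_anc (h : SearchInv M σ) (hp : σ.IsTreePath p (σ.base x) (σ.base y)) {v w : V}
    (hvw : σ.Anc (σ.base v) (σ.base w)) :
    (σ.shrink x y p).Anc ((σ.shrink x y p).base v) ((σ.shrink x y p).base w) := by
  have key : ∀ {a b}, σ.Anc a b → σ.base b = b →
      (σ.shrink x y p).Anc ((σ.shrink x y p).base a) ((σ.shrink x y p).base b) := by
    intro a b hab
    induction hab with
    | refl => exact fun _ => .refl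
    | @tail b c _ hbc ih =>
      intro hc
      obtain ⟨w, hw, rfl⟩ := hbc
      refine (ih (h.base_base w)).trans ?_
      by_cases hcp : c ∈ p ∧ c ≠ σ.base x
      · have hwp : σ.base w ∈ p := hp.mem_of_nodeParent hcp.1 hcp.2 ⟨w, hw, rfl⟩
        rw [State.shrink_base_of_mem (z := σ.base w) (by rwa [h.base_base]),
          State.shrink_base_of_mem (z := c) (by rw [hc]; exact hcp.1)]
      · have hc' : (σ.shrink x y p).base c = c := by
          by_cases hcp' : c ∈ p
          · rw [State.shrink_base_of_mem (by rwa [hc])]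
            exact (not_not.1 fun h' => hcp ⟨hcp', h'⟩).symm
          · rw [State.shrink_base_of_not_mem (by rwa [hc]), hc]
        rw [hc', shrink_base_congr (h.base_base w)]
        exact .single ⟨w, hw, rfl⟩
  have := key hvw (h.base_base w)
  rwa [shrink_base_congr (h.base_base v), shrink_base_congr (h.base_base w)] at this

end SearchInv

namespace StackInv

/-- A blossom step preserves the invariant. The top of the tree path is the node of the innermost
call, and no active node lies below it, so that the contraction moves no active node. -/
theorem blossom (h : StackInv M σ) (hS : SearchInv M σ)
    {x y : V} {p : List V} {E : Set V} {K : List (Frame V)} (hσ : σ.stack = .scan x E :: K)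
    (hyS : y ∈ σ.verts) (hy : y ∈ σ.even) (hp : σ.IsTreePath p (σ.base x) (σ.base y)) :
    StackInv M { σ.shrink x y p with
      stack := .calls (σ.oddVerts p) :: .scan x (E \ {y}) :: K } := by
  obtain ⟨hxA, htop⟩ := h.of_scan hS hσ
  have hx := h.active_even x hxA
  have hodd : ∀ {u}, u ∈ σ.oddVerts p → (σ.shrink x y p).base u = σ.base x := by
    intro u hu
    obtain ⟨hup, hue⟩ := State.mem_oddVerts.1 hu
    exact State.shrink_base_of_mem (by rwa [hS.base_of_not_even hue])
  have hP : ∀ {v}, v ∈ σ.even → (σ.shrink x y p).path v = σ.path v := State.shrink_path_of_even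
  have hxb : (σ.shrink x y p).base x = σ.base x := State.shrink_base_of_mem hp.left_mem
  -- the active nodes lie above the new blossom and are not contracted into it
  have hactb : ∀ {c}, c ∈ σ.active → (σ.shrink x y p).base c = σ.base c := by
    intro c hc
    by_cases hcp : σ.base c ∈ p
    · rw [State.shrink_base_of_mem hcp]
      exact hS.anc_antisymm (hp.anc_left hcp) (htop c hc).1
    · exact State.shrink_base_of_not_mem hcp
  have hactive : ({ σ.shrink x y p with stack := .calls (σ.oddVerts p) :: σ.stack } :
      State V).active = σ.oddVerts p ++ σ.active := rfl
  have hnode : ∀ c ∈ σ.oddVerts p ++ σ.active,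
      ∃ c' ∈ σ.active, (σ.shrink x y p).base c = σ.base c' := by
    intro c hc
    rcases List.mem_append.1 hc with hc | hc
    exacts [⟨x, hxA, hodd hc⟩, ⟨c, hc, hactb hc⟩]
  have hold : ∀ {a b},
      ({ σ.shrink x y p with stack := .calls (σ.oddVerts p) :: σ.stack } : State V).Scanned M a b →
      σ.Scanned M a b := by
    rintro a b ⟨ha | ha, h2, h3, h4, h5⟩
    · exact ⟨ha, h2, h3, h4, fun ⟨F, hF, hab⟩ => h5 ⟨F, List.mem_cons_of_mem _ hF, hab⟩⟩
    · exact (h5 ⟨.calls (σ.oddVerts p), by simp, ha⟩).elim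
  have hpush : StackInv M { σ.shrink x y p with stack := .calls (σ.oddVerts p) :: σ.stack } := by
    refine ⟨?_, ?_, ?_, ?_, ?_, ?_, ?_, ?_, ?_⟩
    · rw [hactive]
      intro v hv
      rcases List.mem_append.1 hv with hv | hv
      exacts [.inr hv, .inl (h.active_even v hv)]
    · intro a E' hE'
      simp only [List.mem_cons, reduceCtorEq, false_or] at hE'
      exact h.edges a E' hE'
    · rw [hactive, List.pairwise_append]
      refine ⟨List.pairwise_of_forall_mem_list fun a ha b hb => ?_,
        h.active_anc.imp fun hab => hS.shrink_anc hp hab, fun a ha c hc => ?_⟩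
      · change (σ.shrink x y p).Anc ((σ.shrink x y p).base b) ((σ.shrink x y p).base a)
        rw [hodd ha, hodd hb]
        exact .refl
      · change (σ.shrink x y p).Anc ((σ.shrink x y p).base c) ((σ.shrink x y p).base a)
        rw [hodd ha, ← hxb]
        exact hS.shrink_anc hp (htop c hc).1
    · rw [hactive, List.pairwise_append]
      refine ⟨?_, h.active_path.imp_of_mem fun {a b} ha _ hab => ?_, fun a ha c hc => ?_⟩
      · -- the path of `a` runs through all the odd vertices of the tree path below `a`
        have hpw : (σ.oddVerts p).Pairwise σ.Anc := hp.pairwise.filter _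
        refine hpw.imp_of_mem fun {a b} ha hb hab => ?_
        change b ∈ (σ.shrink x y p).path a
        obtain ⟨w, S, hw, hwe, hPy, -, hPa⟩ := hS.shrink_path hy hp ha
        obtain ⟨w', S', -, -, hPy', -⟩ := hS.shrink_path hy hp hb
        obtain ⟨-, hae⟩ := State.mem_oddVerts.1 ha
        obtain ⟨-, hbe⟩ := State.mem_oddVerts.1 hb
        have hby : b ∈ σ.path y := by rw [hPy']; simp
        rw [hPa]
        refine List.mem_append_right _ (List.mem_reverse.2 ?_)
        rw [hPy] at hby
        refine (List.mem_append.1 hby).resolve_left fun hbw => ?_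
        have := hS.anc_of_mem_path hwe hbw
        rw [hS.base_of_not_even hbe] at this
        exact hS.acyclic (hab.trans this) ⟨w, hw, rfl⟩
      · change b ∈ (σ.shrink x y p).path a
        rwa [hP (h.active_even a ha)]
      · change c ∈ (σ.shrink x y p).path a
        obtain ⟨w, S, -, -, -, -, hPa⟩ := hS.shrink_path hy hp ha
        rw [hPa]
        exact List.mem_append_left _ (htop c hc).2
    · rw [hactive]
      intro v hv z hz
      change z ∈ (σ.shrink x y p).path v at hz
      rcases List.mem_append.1 hv with hv | hv
      · obtain ⟨w, S, -, -, -, hSp, hPv⟩ := hS.shrink_path hy hp hv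
        rw [hPv] at hz
        rcases List.mem_append.1 hz with hz | hz
        · exact h.path_disjoint x hxA z hz
        · exact fun h' => h.not_anc x hxA z h' (hp.anc_left (hSp z (List.mem_reverse.1 hz)).2)
      · rw [hP (h.active_even v hv)] at hz
        exact h.path_disjoint v hv z hz
    · rw [hactive]
      intro v hv z hz hvz
      change (σ.shrink x y p).Anc ((σ.shrink x y p).base v) ((σ.shrink x y p).base z) at hvz
      obtain ⟨c, hc, hvc⟩ := hnode v hv
      rw [hvc] at hvz
      exact h.not_anc c hc z hz (SearchInv.anc_base_of_anc_shrink hp hvz)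
    · exact fun a b hab => h.scanned_mem a b (hold hab)
    · rw [hactive]
      intro a b hab v hv hvb
      change (σ.shrink x y p).Anc ((σ.shrink x y p).base v) ((σ.shrink x y p).base b) at hvb
      change (σ.shrink x y p).Anc ((σ.shrink x y p).base v) ((σ.shrink x y p).base a)
      obtain ⟨c, hc, hvc⟩ := hnode v hv
      rw [hvc] at hvb
      rw [hvc, ← hactb hc]
      exact hS.shrink_anc hp
        (h.scanned_anc a b (hold hab) c hc (SearchInv.anc_base_of_anc_shrink hp hvb))
    · exact fun a b hab hba =>
        SearchInv.shrink_base_congr (x := x) (y := y) (p := p)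
          (h.scanned_base a b (hold hab) (hold hba))
  have hxy : (σ.shrink x y p).base y = (σ.shrink x y p).base x := by
    rw [hxb, State.shrink_base_of_mem hp.right_mem]
  refine hpush.removeEdge (L := [.calls (σ.oddVerts p)]) (by simp [hσ]) hyS ?_ fun _ => hxy.symm
  intro c _ hcy
  change (σ.shrink x y p).Anc _ ((σ.shrink x y p).base y) at hcy
  rwa [hxy] at hcy

end StackInv

/-! ### The invariant of the execution -/

variable {τ : State V}

/-- The conjunction of the three invariants of `find_ap_set`. -/
structure Inv (M : H.Subgraph) (σ : State V) : Prop where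
  search : SearchInv M σ
  stack : StackInv M σ
  paths : PathsInv M σ

theorem Inv.init (M : H.Subgraph) : Inv M (init M) :=
  ⟨.init M, .init M, .init M⟩

theorem Inv.step (hM : M.IsMatching) (h : Inv M σ) (hστ : Step M σ τ) : Inv M τ := by
  obtain ⟨hS, hK, hC⟩ := h
  cases hστ with
  | skipRoot f hσ hf hfC => exact ⟨hS.withStack _ _, hK.withTodo _, hC.skipRoot hfC⟩
  | newRoot f hσ hf hfC =>
    have hfS := hC.not_mem_verts_of_todo hf hfC
    exact ⟨(hS.addRoot (hC.todo_free f hf) hfS).withStack _ _, hK.newRoot hS hC hσ hfS hfC _,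
      hC.newRoot f _⟩
  | augment x y E K hσ hyE hyS hy =>
    obtain ⟨hxA, -⟩ := hK.of_scan hS hσ
    have hx := hK.active_even x hxA
    obtain ⟨hxy, -⟩ := hK.edges x E (by simp [hσ]) y hyE
    exact ⟨hS.augment hx hy hyS, hK.augment hS hσ,
      hC.augment hS hx hxy hy hyS (hK.path_disjoint x hxA)⟩
  | grow x y y' E K hσ hyE hyS hyy' =>
    obtain ⟨hxA, -⟩ := hK.of_scan hS hσ
    have hx := hK.active_even x hxA
    obtain ⟨hxy, hxy'⟩ := hK.edges x E (by simp [hσ]) y hyE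
    exact ⟨(hS.grow hM hx hxy hxy' hyS hyy').withStack _ _, hK.grow hM hS hC hσ hyE hyS hyy',
      hC.grow hyy' _⟩
  | blossom x y p E K hσ hyE hyS hye _ hp =>
    obtain ⟨hxA, -⟩ := hK.of_scan hS hσ
    have hx := hK.active_even x hxA
    have hy := hS.base_mem_even_iff.1 hye
    obtain ⟨hxy, hxy'⟩ := hK.edges x E (by simp [hσ]) y hyE
    exact ⟨(hS.shrink hM hx hy hxy hxy' hp).withStack _ _, hK.blossom hS hσ hyS hy hp,
      hC.shrink hS hy hp _⟩
  | skipEdge x y E K hσ hyE hyS hskip =>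
    exact ⟨hS.withStack _ _, hK.skipEdge hS hσ hyS hskip, hC.withStack _⟩
  | scanDone x K hσ => exact ⟨hS.withStack _ _, hK.scanDone hσ, hC.withStack _⟩
  | callNext u us K hσ => exact ⟨hS.withStack _ _, hK.callNext hσ, hC.withStack _⟩
  | callsDone K hσ => exact ⟨hS.withStack _ _, hK.callsDone hσ, hC.withStack _⟩

theorem Inv.of_reachable (hM : M.IsMatching)
    (h : Relation.ReflTransGen (Step M) (MaxAugPaths.init M) σ) :
    Inv M σ := by
  induction h with
  | refl => exact .init M
  | tail _ hστ ih => exact ih.step hM hστ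

/-! ### Progress and termination -/

theorem finished_of_forall_not_step (hM : M.IsMatching) (h : ∀ τ, ¬ Step M σ τ) : Finished σ := by
  classical
  rcases hσ : σ.stack with _ | ⟨F, K⟩
  · refine ⟨hσ, Set.eq_empty_of_forall_notMem fun f hf => ?_⟩
    by_cases hfC : f ∈ σ.pathVerts
    · exact h _ (.skipRoot σ f hσ hf hfC)
    · exact h _ (.newRoot σ f hσ hf hfC)
  exfalso
  rcases F with ⟨x, E⟩ | us
  · rcases E.eq_empty_or_nonempty with rfl | ⟨y, hy⟩
    · exact h _ (.scanDone σ x K hσ)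
    by_cases hyS : y ∈ σ.verts
    · by_cases hb : σ.base y ∈ σ.even ∧ σ.IsProperDescendant (σ.base y) (σ.base x)
      · obtain ⟨p, hp⟩ := hb.2.exists_isTreePath
        exact h _ (.blossom σ x y p E K hσ hy hyS hb.1 hb.2 hp)
      · exact h _ (.skipEdge σ x y E K hσ hy hyS hb)
    · by_cases hyM : y ∈ M.verts
      · obtain ⟨y', hyy', -⟩ := hM hyM
        exact h _ (.grow σ x y y' E K hσ hy hyS hyy')
      · exact h _ (.augment σ x y E K hσ hy hyS hyM)
  · cases us with
    | nil => exact h _ (.callsDone σ K hσ)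
    | cons u us => exact h _ (.callNext σ u us K hσ)

/-- A bound for the number of steps that are needed to work off a stack entry, if no step changes
the search structure. -/
noncomputable def Frame.weight : Frame V → ℕ
  | .scan _ E => 2 * E.ncard + 1
  | .calls us => us.length * (2 * Nat.card V + 2) + 1

/-- The termination measure: every step decreases it lexicographically. -/
noncomputable def State.measure (σ : State V) : ℕ × ℕ × ℕ × ℕ :=
  (σ.todo.ncard, σ.vertsᶜ.ncard, σ.evenᶜ.ncard, (σ.stack.map Frame.weight).sum)

/-- The lexicographic order of the termination measure. -/
abbrev measureLT : ℕ × ℕ × ℕ × ℕ → ℕ × ℕ × ℕ × ℕ → Prop :=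
  Prod.Lex (· < ·) (Prod.Lex (· < ·) (Prod.Lex (· < ·) (· < ·)))

theorem wellFounded_measureLT : WellFounded measureLT :=
  WellFounded.prod_lex Nat.lt_wfRel.wf
    (WellFounded.prod_lex Nat.lt_wfRel.wf (WellFounded.prod_lex Nat.lt_wfRel.wf Nat.lt_wfRel.wf))

section termination

variable [Finite V]

theorem Step.measureLT (h : Step M σ τ) : measureLT τ.measure σ.measure := by
  have hcompl : ∀ {A B : Set V} {v : V}, A ⊆ B → v ∉ A → v ∈ B → Bᶜ.ncard < Aᶜ.ncard :=
    fun hAB hA hB => Set.ncard_lt_ncard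
      ⟨Set.compl_subset_compl.2 hAB, fun h' => h' hA hB⟩ (Set.toFinite _)
  have hdiff : ∀ {A : Set V} {v : V}, v ∈ A → (A \ {v}).ncard < A.ncard := fun hv =>
    Set.ncard_sdiff_singleton_lt_of_mem hv (Set.toFinite _)
  have hstack : ∀ {K : List (Frame V)},
      (K.map Frame.weight).sum < (σ.stack.map Frame.weight).sum →
      MaxAugPaths.measureLT ({ σ with stack := K } : State V).measure σ.measure :=
    fun hK => .right _ (.right _ (.right _ hK))
  cases h with
  | skipRoot f hσ hf hfC => exact .left _ _ (hdiff hf)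
  | newRoot f hσ hf hfC => exact .left _ _ (hdiff hf)
  | augment x y E K hσ hyE hyS hy =>
    exact .right _ (.left _ _ (hcompl (Set.subset_insert _ _) hyS (.inl rfl)))
  | grow x y y' E K hσ hyE hyS hyy' =>
    refine .right _ (.left _ _ (hcompl ?_ hyS (.inl rfl)))
    exact (Set.subset_insert _ _).trans (Set.subset_insert _ _)
  | blossom x y p E K hσ hyE hyS hye hd hp =>
    rcases ho : σ.oddVerts p with _ | ⟨u, us⟩
    · have hev : (σ.shrink x y p).even = σ.even := by
        change σ.even ∪ {u | u ∈ σ.oddVerts p} = _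
        simp [ho]
      refine .right _ (.right _ ?_)
      change Prod.Lex _ _ ((σ.shrink x y p).evenᶜ.ncard, _) _
      rw [hev]
      refine .right _ ?_
      have := hdiff hyE
      simp only [hσ, List.map_cons, List.sum_cons, Frame.weight, List.length_nil]
      omega
    · have hu : u ∈ σ.oddVerts p := by rw [ho]; simp
      exact .right _ (.right _ (.left _ _
        (hcompl Set.subset_union_left (State.mem_oddVerts.1 hu).2 (.inr hu))))
  | skipEdge x y E K hσ hyE hyS hskip =>
    have := hdiff hyE
    refine hstack ?_
    simp only [hσ, List.map_cons, List.sum_cons, Frame.weight]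
    omega
  | scanDone x K hσ => exact hstack (by simp [hσ, Frame.weight])
  | callNext u us K hσ =>
    refine hstack ?_
    have := Set.ncard_le_card {y | H.Adj u y ∧ ¬ M.Adj u y}
    simp only [hσ, call, List.map_cons, List.sum_cons, Frame.weight, List.length_cons, Nat.add_mul]
    omega
  | callsDone K hσ => exact hstack (by simp [hσ, Frame.weight])

theorem no_infinite_run (M : H.Subgraph) :
    ¬ ∃ run : ℕ → State V, run 0 = init M ∧ ∀ n, Step M (run n) (run (n + 1)) := by
  rintro ⟨run, -, hrun⟩
  have : IsWellFounded _ measureLT := ⟨wellFounded_measureLT⟩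
  obtain ⟨n, hn⟩ := WellFounded.not_rel_apply_succ (r := measureLT) fun n => (run n).measure
  exact hn (hrun n).measureLT

end termination

/-! ### Maximality -/

theorem Finished.scanned (hσ : Finished σ) {x y : V} (hx : x ∈ σ.even) (hxC : x ∉ σ.pathVerts)
    (hxy : H.Adj x y) (hxy' : ¬ M.Adj x y) : σ.Scanned M x y :=
  ⟨hx, hxC, hxy, hxy', by simp [State.Unscanned, hσ.1]⟩

/-- An augmenting path that is disjoint from the collected paths, at its positions of even number,
is at an even vertex of a blossom whose base it has visited already. -/
theorem Inv.even_of_isAugmentingPath (h : Inv M σ) (hσ : Finished σ)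
    {q : List V} (hq : IsAugmentingPath M q) (hqC : ∀ v ∈ q, v ∉ σ.pathVerts) (i : ℕ)
    (hi : 2 * i < q.length) :
    q[2 * i] ∈ σ.even ∧ ∃ j, ∃ hj : j ≤ 2 * i, σ.base q[2 * i] = q[j] := by
  obtain ⟨hS, hK, hC⟩ := h
  induction i with
  | zero =>
    have hf : IsFree M q[0] := hq.head_free _ (List.head?_eq_getElem? ▸ List.getElem?_eq_getElem hi)
    have he : q[0] ∈ σ.even :=
      (hC.free_done _ hf (by simp [hσ.2])).resolve_left (hqC _ (List.getElem_mem _))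
    exact ⟨he, 0, le_rfl, (hS.free_even he hf).1⟩
  | succ i ih =>
    obtain ⟨he, j, hj, hbj⟩ := ih (by omega)
    have hadj : H.Adj q[2 * i] q[2 * i + 1] := List.isChain_iff_getElem.1 hq.isChain _ (by omega)
    have hnM : ¬ M.Adj q[2 * i] q[2 * i + 1] := by
      rw [hq.alternating _ (by omega)]
      simp
    have hM' : M.Adj q[2 * i + 1] q[2 * (i + 1)] :=
      (hq.alternating (2 * i + 1) (by omega)).2 (by simp)
    have hsc : σ.Scanned M _ _ := hσ.scanned he (hqC _ (List.getElem_mem _)) hadj hnM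
    have hyS := hK.scanned_mem _ _ hsc
    by_cases hye : q[2 * i + 1] ∈ σ.even
    · have hb := hK.scanned_base _ _ hsc
        (hσ.scanned hye (hqC _ (List.getElem_mem _)) hadj.symm fun h' => hnM h'.symm)
      -- the base was visited earlier, so `q[2 * i + 1]` is not the base and has its mate in the
      -- same blossom
      have hne : σ.base q[2 * i + 1] ≠ q[2 * i + 1] := by
        rw [← hb, hbj]
        intro h'
        have := (hq.nodup.getElem_inj_iff).1 h'
        omega
      have hb' := hS.base_mate hye hne hM'
      refine ⟨hS.base_mem_even_iff.1 (hb' ▸ hS.base_mem_even hye), j, by omega, ?_⟩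
      rw [hb', ← hb, hbj]
    · obtain ⟨h1, h2, -⟩ := hS.mate_of_odd hyS hye hM'
      exact ⟨h1, _, le_rfl, h2⟩

theorem Inv.isMaximalAugmentingSet (h : Inv M σ) (hσ : Finished σ) :
    IsMaximalAugmentingSet M σ.paths := by
  refine ⟨h.paths.augmenting, h.paths.disjoint, ?_⟩
  rintro ⟨q, hq, hqd⟩
  have hqC : ∀ v ∈ q, v ∉ σ.pathVerts := fun v hv ⟨p, hp, hvp⟩ => hqd p hp hv hvp
  have hlen := hq.two_le
  have hlast : IsFree M q[q.length - 1] :=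
    hq.last_free _ (by rw [List.getLast?_eq_getElem?, List.getElem?_eq_getElem])
  rcases Nat.even_or_odd' q.length with ⟨k, hk | hk⟩
  · -- the last edge is non-matching and lies in a blossom, whose base is the free last vertex
    obtain ⟨i, rfl⟩ : ∃ i, k = i + 1 := ⟨k - 1, by omega⟩
    obtain ⟨he, j, hj, hbj⟩ := h.even_of_isAugmentingPath hσ hq hqC i (by omega)
    have hi : 2 * i + 1 < q.length := by omega
    have hf : IsFree M q[2 * i + 1] := by
      convert hlast using 2
      omega
    have hadj : H.Adj q[2 * i] q[2 * i + 1] := List.isChain_iff_getElem.1 hq.isChain _ hi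
    have hnM : ¬ M.Adj q[2 * i] q[2 * i + 1] := fun h' => hf h'.snd_mem
    have hye : q[2 * i + 1] ∈ σ.even :=
      (h.paths.free_done _ hf (by simp [hσ.2])).resolve_left (hqC _ (List.getElem_mem _))
    have hb := h.stack.scanned_base _ _
      (hσ.scanned he (hqC _ (List.getElem_mem _)) hadj hnM)
      (hσ.scanned hye (hqC _ (List.getElem_mem _)) hadj.symm fun h' => hnM h'.symm)
    rw [hbj, (h.search.free_even hye hf).1, hq.nodup.getElem_inj_iff] at hb
    omega
  · -- the last edge would be a matching edge
    obtain ⟨i, rfl⟩ : ∃ i, k = i + 1 := ⟨k - 1, by omega⟩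
    have hM' : M.Adj q[2 * i + 1] q[2 * i + 1 + 1] :=
      (hq.alternating (2 * i + 1) (by omega)).2 (by simp)
    refine hlast ?_
    convert hM'.snd_mem using 2
    omega

end MaxAugPaths

theorem mainTheorem4 {V : Type*} [Finite V] (H : SimpleGraph V) (M : H.Subgraph)
    (hM : M.IsMatching) :
    (¬ ∃ run : ℕ → MaxAugPaths.State V, run 0 = MaxAugPaths.init M ∧
      ∀ n, MaxAugPaths.Step M (run n) (run (n + 1))) ∧
    ∀ σ : MaxAugPaths.State V,
      Relation.ReflTransGen (MaxAugPaths.Step M) (MaxAugPaths.init M) σ →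
      (∀ τ, ¬ MaxAugPaths.Step M σ τ) →
      MaxAugPaths.Finished σ ∧ MaxAugPaths.IsMaximalAugmentingSet M σ.paths := by
  refine ⟨MaxAugPaths.no_infinite_run M, fun σ hσ hend => ?_⟩
  have hfin := MaxAugPaths.finished_of_forall_not_step hM hend
  exact ⟨hfin, (MaxAugPaths.Inv.of_reachable hM hσ).isMaximalAugmentingSet hfin⟩
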